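/- A Boolean circuit $X:\{0,1\}^n\to\{0,1\}^m$ encodes the distribution of $X(r)$ for uniformly random $r\in\{0,1\}^n$. For two circuits $X,Y:\{0,1\}^n\to\{0,1\}^m$ let $$SD(X,Y)=\tfrac12\sum_{y\in\{0,1\}^m}\bigl|\Pr_r[X(r)=y]-\Pr_r[Y(r)=y]\bigr|,$$ $$Disj(X,Y)=2^{-n}\,\bigl|\{i\in\{0,1\}^n:\ X(i)\neq Y(j)\text{ for all }j\in\{0,1\}^n\}\bigr|,$$ and $\textrm{mut-}Disj(X,Y)=\min(Disj(X,Y),Disj(Y,X))$. For real numbers $\alpha,\beta$, let $\textrm{mut-}IID^{\alpha,\beta}$ be the promise problem whose instances are pairs $(X,Y)$ of circuits with the same number of inputs and the same number of outputs (given by their descriptions), whose Yes instances are the pairs with $SD(X,Y)\le\alpha$, and whose No instances are the pairs with $\textrm{mut-}Disj(X,Y)\ge\beta$. A promise problem $\Pi$ reduces to $\Omega$, written $\Pi\preccurlyeq\Omega$, if there is a polynomial-time computable function that maps Yes instances of $\Pi$ to Yes instances of $\Omega$ and No instances of $\Pi$ to No instances of $\Omega$. **Proposition (polarization).** Let $a<b$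 be real constants. Then $$\textrm{mut-}IID^{a,b}\ \preccurlyeq\ \textrm{mut-}IID^{2^{-k},\,1-2^{-k}}\qquad\text{for every } k\in\mathbb N,$$ and this holds uniformly in $k$: there is a function $f$ (depending only on $a,b$), computable in time polynomial in the length of its input $(X,Y,1^k)$, such that for all $k\in\mathbb N$ and all pairs $(X,Y)$, with $(A,B)=f(X,Y,1^k)$, $$SD(X,Y)\le a\ \Rightarrow\ SD(A,B)\le 2^{-k},\qquad \textrm{mut-}Disj(X,Y)\ge b\ \Rightarrow\ \textrm{mut-}Disj(A,B)\ge 1-2^{-k}.$$ -/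

import Mathlib

/-! ### Boolean circuits -/

/-- A node of a Boolean circuit with input variables `x_0, …, x_{n-1}`: an input variable, a
constant, or a gate that reads the values of the nodes with the given positions. -/
inductive Node (n : ℕ) : Type
  | var (i : Fin n)
  | const (c : Bool)
  | not (p : ℕ)
  | and (p q : ℕ)
  | or (p q : ℕ)

namespace Node

/-- The positions of the nodes that a node reads. -/
def preds {n : ℕ} : Node n → List ℕ
  | var _ => []
  | const _ => []
  | not p => [p]
  | and p q => [p, q]
  | or p q => [p, q]

/-- The value of a node on input `x`, where `v` lists the values of the earlier nodes. -/
def eval {n : ℕ} (x : Fin n → Bool) (v : List Bool) : Node n → Bool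
  | var i => x i
  | const c => c
  | not p => !(v.getD p false)
  | and p q => v.getD p false && v.getD q false
  | or p q => v.getD p false || v.getD q false

end Node

/-- A Boolean circuit with `n` inputs and `m` outputs: a topologically ordered list of nodes,
each of which reads only earlier nodes, and a choice of `m` output nodes. -/
structure Circuit (n m : ℕ) where
  nodes : List (Node n)
  outputs : Fin m → ℕ
  preds_lt : ∀ (j : ℕ) (hj : j < nodes.length), ∀ p ∈ (nodes[j]).preds, p < j
  outputs_lt : ∀ o, outputs o < nodes.length

namespace Circuit

/-- The values of all nodes, in order, on input `x`. -/
def values {n m : ℕ} (C : Circuit n m) (x : Fin n → Bool) : List Bool :=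
  C.nodes.foldl (fun v g => v ++ [g.eval x v]) []

/-- The function `{0,1}^n → {0,1}^m` that the circuit computes. -/
def eval {n m : ℕ} (C : Circuit n m) (x : Fin n → Bool) : Fin m → Bool :=
  fun o => (C.values x).getD (C.outputs o) false

/-- The distribution encoded by a circuit: the probability of the output `y` on a uniformly
random input. -/
noncomputable def prob {n m : ℕ} (C : Circuit n m) (y : Fin m → Bool) : ℝ :=
  ((Finset.univ.filter fun x : Fin n → Bool => C.eval x = y).card : ℝ) / 2 ^ n

end Circuit

/-! ### Statistical difference and disjointness -/

/-- The statistical difference of the encoded distributions. -/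
noncomputable def SD {n m : ℕ} (X Y : Circuit n m) : ℝ :=
  (1 / 2) * ∑ y : Fin m → Bool, |X.prob y - Y.prob y|

/-- The fraction of the inputs of `X` whose output is not in the image of `Y`. -/
noncomputable def Disj {n m : ℕ} (X Y : Circuit n m) : ℝ :=
  ((Finset.univ.filter fun i : Fin n → Bool =>
    ∀ j : Fin n → Bool, X.eval i ≠ Y.eval j).card : ℝ) / 2 ^ n

/-- The mutual disjointness. -/
noncomputable def mutDisj {n m : ℕ} (X Y : Circuit n m) : ℝ :=
  min (Disj X Y) (Disj Y X)

/-! ### Promise problems -/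

/-- A promise problem, given by its Yes instances and its No instances. (For `mutIID a b` these
are disjoint whenever `a < b`, see `mutIID_disjoint`.) -/
structure PromiseProblem (α : Type) where
  yes : Set α
  no : Set α

/-- A pair of circuits with the same number of inputs and the same number of outputs. -/
structure CircuitPair where
  n : ℕ
  m : ℕ
  X : Circuit n m
  Y : Circuit n m

/-- The problem mut-IID with parameters `a` and `b`. -/
def mutIID (a b : ℝ) : PromiseProblem CircuitPair where
  yes := {P | SD P.X P.Y ≤ a}
  no := {P | b ≤ mutDisj P.X P.Y}

theorem Disj_le_SD {n m : ℕ} (X Y : Circuit n m) : Disj X Y ≤ SD X Y := by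
  classical
  have sum_prob : ∀ C : Circuit n m, ∑ y, C.prob y = 1 := by
    intro C
    unfold Circuit.prob
    rw [← Finset.sum_div, ← Nat.cast_sum, ← Finset.card_eq_sum_card_fiberwise]
    · simp
    · intro x _; simp
  set S : Finset (Fin m → Bool) := Finset.univ.filter fun y => ∀ j, y ≠ Y.eval j with hS
  have hY : ∀ y ∈ S, Y.prob y = 0 := by
    intro y hy
    simp only [hS, Finset.mem_filter, Finset.mem_univ, true_and] at hy
    simp only [Circuit.prob, div_eq_zero_iff, Nat.cast_eq_zero, Finset.card_eq_zero]
    left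
    ext x
    simpa using fun h => hy x h.symm
  have hD : Disj X Y = ∑ y ∈ S, X.prob y := by
    unfold Disj Circuit.prob
    rw [← Finset.sum_div, ← Nat.cast_sum]
    congr 2
    rw [Finset.card_eq_sum_card_fiberwise (f := X.eval) (t := S)]
    · refine Finset.sum_congr rfl fun y hy => ?_
      congr 1
      ext x
      simp only [hS, Finset.mem_filter, Finset.mem_univ, true_and] at hy ⊢
      constructor
      · exact fun h => h.2
      · rintro rfl; exact ⟨hy, rfl⟩
    · intro x hx; simpa [hS] using hx
  have h1 : Disj X Y = ∑ y ∈ S, (X.prob y - Y.prob y) := by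
    rw [hD]
    exact Finset.sum_congr rfl fun y hy => by rw [hY y hy, sub_zero]
  have h2 : ∑ y ∈ S, (X.prob y - Y.prob y) ≤ ∑ y ∈ S, |X.prob y - Y.prob y| :=
    Finset.sum_le_sum fun y _ => le_abs_self _
  have h3 : -∑ y ∈ Sᶜ, (X.prob y - Y.prob y) ≤ ∑ y ∈ Sᶜ, |X.prob y - Y.prob y| := by
    rw [← Finset.sum_neg_distrib]
    exact Finset.sum_le_sum fun y _ => neg_le_abs _
  have h4 := Finset.sum_add_sum_compl S fun y => X.prob y - Y.prob y
  have h5 := Finset.sum_add_sum_compl S fun y => |X.prob y - Y.prob y|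
  have h6 : ∑ y, (X.prob y - Y.prob y) = 0 := by
    rw [Finset.sum_sub_distrib, sum_prob, sum_prob, sub_self]
  unfold SD
  linarith

theorem mutIID_disjoint {a b : ℝ} (h : a < b) : Disjoint (mutIID a b).yes (mutIID a b).no := by
  rw [Set.disjoint_left]
  intro P hy hn
  have h1 : SD P.X P.Y ≤ a := hy
  have h2 : b ≤ mutDisj P.X P.Y := hn
  have h3 := Disj_le_SD P.X P.Y
  have h4 : mutDisj P.X P.Y ≤ Disj P.X P.Y := min_le_left _ _
  linarith

/-! ### Encodings over a finite alphabet -/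

/-- The alphabet in which instances are written. -/
inductive Letter : Type
  | tick
  | comma
  | tt
  | ff
  | var
  | not
  | and
  | or
  | out
  | fin
  deriving DecidableEq

instance : Fintype Letter where
  elems := {.tick, .comma, .tt, .ff, .var, .not, .and, .or, .out, .fin}
  complete x := by cases x <;> decide

/-- A natural number in unary, closed by a comma. -/
def encodeUnary (k : ℕ) : List Letter :=
  List.replicate k Letter.tick ++ [Letter.comma]

def encodeNode {n : ℕ} : Node n → List Letter
  | .var i => Letter.var :: encodeUnary i
  | .const true => [Letter.tt]
  | .const false => [Letter.ff]
  | .not p => Letter.not :: encodeUnary p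
  | .and p q => Letter.and :: (encodeUnary p ++ encodeUnary q)
  | .or p q => Letter.or :: (encodeUnary p ++ encodeUnary q)

/-- A circuit is written as the list of its nodes followed by the list of its output nodes. -/
def encodeCircuit {n m : ℕ} (C : Circuit n m) : List Letter :=
  C.nodes.flatMap encodeNode ++
    ((List.ofFn C.outputs).flatMap fun p => Letter.out :: encodeUnary p) ++ [Letter.fin]

/-- A pair of circuits is written as the number of inputs followed by the two circuits. -/
def encodePair (P : CircuitPair) : List Letter :=
  encodeUnary P.n ++ encodeCircuit P.X ++ encodeCircuit P.Y

/-- The encoding of `(X, Y, 1^k)`. -/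
def encodePairParam (I : CircuitPair × ℕ) : List Letter :=
  encodePair I.1 ++ encodeUnary I.2

theorem encodeUnary_append_inj {k l : ℕ} {s t : List Letter}
    (h : encodeUnary k ++ s = encodeUnary l ++ t) : k = l ∧ s = t := by
  induction k generalizing l with
  | zero =>
    cases l with
    | zero => simpa [encodeUnary] using h
    | succ l => simp [encodeUnary, List.replicate_succ] at h
  | succ k ih =>
    cases l with
    | zero => simp [encodeUnary, List.replicate_succ] at h
    | succ l =>
      have := @ih l (by simpa [encodeUnary, List.replicate_succ] using h)
      exact ⟨by omega, this.2⟩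

theorem encodeNode_append_inj {n : ℕ} {g g' : Node n} {s t : List Letter}
    (h : encodeNode g ++ s = encodeNode g' ++ t) : g = g' ∧ s = t := by
  have two : ∀ {p q p' q' : ℕ}, encodeUnary p ++ (encodeUnary q ++ s) =
      encodeUnary p' ++ (encodeUnary q' ++ t) → (p = p' ∧ q = q') ∧ s = t := by
    intro p q p' q' h
    obtain ⟨h1, h2⟩ := encodeUnary_append_inj h
    obtain ⟨h3, h4⟩ := encodeUnary_append_inj h2
    exact ⟨⟨h1, h3⟩, h4⟩
  rcases g with i | (_ | _) | p | ⟨p, q⟩ | ⟨p, q⟩ <;>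
    rcases g' with i' | (_ | _) | p' | ⟨p', q'⟩ | ⟨p', q'⟩ <;>
    simp only [encodeNode, List.cons_append, List.append_assoc, List.nil_append, List.cons.injEq,
      reduceCtorEq, false_and, true_and] at h
  · obtain ⟨h1, h2⟩ := encodeUnary_append_inj h
    exact ⟨by rw [Fin.ext h1], h2⟩
  · exact ⟨rfl, h⟩
  · exact ⟨rfl, h⟩
  · obtain ⟨h1, h2⟩ := encodeUnary_append_inj h
    exact ⟨by rw [h1], h2⟩
  · obtain ⟨⟨h1, h2⟩, h3⟩ := two h
    exact ⟨by rw [h1, h2], h3⟩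
  · obtain ⟨⟨h1, h2⟩, h3⟩ := two h
    exact ⟨by rw [h1, h2], h3⟩

theorem encodeOutputs_append_inj {L L' : List ℕ} {s t : List Letter}
    (h : (L.flatMap fun p => Letter.out :: encodeUnary p) ++ Letter.fin :: s =
      (L'.flatMap fun p => Letter.out :: encodeUnary p) ++ Letter.fin :: t) : L = L' ∧ s = t := by
  induction L generalizing L' with
  | nil => cases L' <;> simp_all
  | cons p L ih =>
    cases L' with
    | nil => simp at h
    | cons p' L' =>
      simp only [List.flatMap_cons, List.cons_append, List.append_assoc, List.cons.injEq,
        true_and] at h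
      obtain ⟨h1, h2⟩ := encodeUnary_append_inj h
      obtain ⟨h3, h4⟩ := ih h2
      exact ⟨by rw [h1, h3], h4⟩

theorem encodeBody_append_inj {n : ℕ} {N N' : List (Node n)} {L L' : List ℕ} {s t : List Letter}
    (h : N.flatMap encodeNode ++
        ((L.flatMap fun p => Letter.out :: encodeUnary p) ++ Letter.fin :: s) =
      N'.flatMap encodeNode ++
        ((L'.flatMap fun p => Letter.out :: encodeUnary p) ++ Letter.fin :: t)) :
    N = N' ∧ L = L' ∧ s = t := by
  have key : ∀ (g : Node n) (r : List Letter) (M : List ℕ) (u : List Letter),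
      encodeNode g ++ r ≠ (M.flatMap fun p => Letter.out :: encodeUnary p) ++ Letter.fin :: u := by
    intro g r M u h
    rcases g with i | (_ | _) | p | ⟨p, q⟩ | ⟨p, q⟩ <;> cases M <;> simp [encodeNode] at h
  induction N generalizing N' with
  | nil =>
    cases N' with
    | nil => exact ⟨rfl, encodeOutputs_append_inj (by simpa using h)⟩
    | cons g' N' =>
      simp only [List.flatMap_nil, List.nil_append, List.flatMap_cons, List.append_assoc] at h
      exact (key _ _ _ _ h.symm).elim
  | cons g N ih =>
    cases N' with
    | nil =>
      simp only [List.flatMap_nil, List.nil_append, List.flatMap_cons, List.append_assoc] at h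
      exact (key _ _ _ _ h).elim
    | cons g' N' =>
      simp only [List.flatMap_cons, List.append_assoc] at h
      obtain ⟨h1, h2⟩ := encodeNode_append_inj h
      obtain ⟨h3, h4⟩ := ih h2
      exact ⟨by rw [h1, h3], h4⟩

theorem encodeCircuit_append_inj {n m m' : ℕ} {C : Circuit n m} {C' : Circuit n m'}
    {s t : List Letter} (h : encodeCircuit C ++ s = encodeCircuit C' ++ t) :
    m = m' ∧ HEq C C' ∧ s = t := by
  obtain ⟨h1, h2, h3⟩ := encodeBody_append_inj (N := C.nodes) (N' := C'.nodes)
    (L := List.ofFn C.outputs) (L' := List.ofFn C'.outputs) (s := s) (t := t)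
    (by simpa [encodeCircuit] using h)
  have hm : m = m' := by simpa using congrArg List.length h2
  subst hm
  refine ⟨rfl, heq_of_eq ?_, h3⟩
  cases C
  cases C'
  obtain rfl := h1
  obtain rfl := List.ofFn_injective h2
  rfl

theorem encodePair_append_inj {P Q : CircuitPair} {s t : List Letter}
    (h : encodePair P ++ s = encodePair Q ++ t) : P = Q ∧ s = t := by
  rcases P with ⟨n, m, X, Y⟩
  rcases Q with ⟨n', m', X', Y'⟩
  simp only [encodePair, List.append_assoc] at h
  obtain ⟨rfl, h2⟩ := encodeUnary_append_inj h
  obtain ⟨rfl, h3, h4⟩ := encodeCircuit_append_inj h2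
  obtain ⟨-, h5, h6⟩ := encodeCircuit_append_inj h4
  exact ⟨by rw [eq_of_heq h3, eq_of_heq h5], h6⟩

/-- Distinct instances have distinct encodings. -/
theorem encodePair_injective : Function.Injective encodePair := fun P Q h =>
  (encodePair_append_inj (s := []) (t := []) (by rw [h])).1

theorem encodePairParam_injective : Function.Injective encodePairParam := by
  rintro ⟨P, k⟩ ⟨Q, l⟩ h
  obtain ⟨h1, h2⟩ := encodePair_append_inj h
  have h3 := (encodeUnary_append_inj (s := []) (t := []) (congrArg (· ++ []) h2)).1
  exact Prod.ext h1 h3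

/-! ### Polynomial-time reductions -/

/-- `f` is computed by a (multi-stack) Turing machine within a number of steps that is bounded by
a polynomial in the length of the encoded input. -/
def PolyTime {α β : Type} (ea : α → List Letter) (eb : β → List Letter) (f : α → β) : Prop :=
  Nonempty (Turing.TM2ComputableInPolyTime ea eb f)

/-- `f` maps Yes instances of `P` to Yes instances of `Q` and No instances to No instances. -/
def MapsInstances {α β : Type} (P : PromiseProblem α) (Q : PromiseProblem β) (f : α → β) : Prop :=
  (∀ x ∈ P.yes, f x ∈ Q.yes) ∧ (∀ x ∈ P.no, f x ∈ Q.no)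

/-- Polynomial-time (many-one) reducibility of promise problems about pairs of circuits. -/
def Reduces (P Q : PromiseProblem CircuitPair) : Prop :=
  ∃ f : CircuitPair → CircuitPair, PolyTime encodePair encodePair f ∧ MapsInstances P Q f

/-- Reducibility of `P` to the family `Q k`, uniformly in `k`: one polynomial-time function that
is given the instance together with `1^k`. -/
def ReducesUniformly (P : PromiseProblem CircuitPair) (Q : ℕ → PromiseProblem CircuitPair) :
    Prop :=
  ∃ f : CircuitPair × ℕ → CircuitPair, PolyTime encodePairParam encodePair f ∧
    ∀ k, MapsInstances P (Q k) fun I => f (I, k)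

/-! ### A structured language for stack machines -/

/-! A pair of circuits is treated as one circuit W(c, r) with a selector bit c: X is W(0, ·) and Y
is W(1, ·). Two doublings act on such circuits. The XOR step (`double true`) draws a random bit t
and outputs (W(t, r), W(c ⊕ t, r')). The product step (`double false`) outputs (W(c, r), W(c, r')).

XOR squares the statistical difference exactly (`sd_double_true`), and it turns a common lower bound
b ≥ 0 on the two disjointnesses into b² (`disj_double_true`). The product at most doubles the
statistical difference (`sd_double_false`) and squares 1 - Disj exactly (`disj_double_false`). So
under XOR the two quantities decay at the same rate, and a mere gap a < b between constants is
enough. For 0 < a < b ≤ 1, h XOR steps make b^(2^h) exceed a^(2^h) by any desired factor, and then j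
product steps bring both the statistical difference and 1 - Disj below 1/8, on Yes and No instances
respectively (`exists_separating_powers`).

From there one round, XOR followed by product, turns an error u/4 into at most u²/4 in either case
(`sd_round`, `one_sub_disj_round`), so `Nat.size k` rounds reach 2^(-k). The numbers h and j depend
only on a and b. Each round at most quadruples the circuit, up to an additive constant, and there
are about log k rounds, so the result has size polynomial in the input and k.

The rest of the work is an actual Turing machine. Programs of a small structured language (`Prog`)
are compiled to labelled stack-machine code. `Runs` states the effect of a program together with a
time bound and is compositional, so each program is verified like an ordinary imperative one;
`polyTime_of_runs` converts the result into polynomial-time computability. Outside the range a < 1,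
b > 0, one side of the promise is empty and a constant map suffices. -/

/-- The stacks of the machine. -/
inductive Stk : Type
  | inp | out | nn | kk | nd | os | nr | orr | bk | t1 | t2 | tm | dv | dp | cc
  deriving DecidableEq

instance : Fintype Stk where
  elems := {.inp, .out, .nn, .kk, .nd, .os, .nr, .orr, .bk, .t1, .t2, .tm, .dv, .dp, .cc}
  complete x := by cases x <;> decide

/-- The contents of the stacks, the top of a stack being the head of the list. -/
@[ext]
structure Mem where
  inp : List Letter := []
  out : List Letter := []
  nn : List Letter := []
  kk : List Letter := []
  nd : List Letter := []
  os : List Letter := []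
  nr : List Letter := []
  orr : List Letter := []
  bk : List Letter := []
  t1 : List Letter := []
  t2 : List Letter := []
  tm : List Letter := []
  dv : List Letter := []
  dp : List Letter := []
  cc : List Letter := []

namespace Mem

def get (s : Mem) : Stk → List Letter
  | .inp => s.inp
  | .out => s.out
  | .nn => s.nn
  | .kk => s.kk
  | .nd => s.nd
  | .os => s.os
  | .nr => s.nr
  | .orr => s.orr
  | .bk => s.bk
  | .t1 => s.t1
  | .t2 => s.t2
  | .tm => s.tm
  | .dv => s.dv
  | .dp => s.dp
  | .cc => s.cc

def set (s : Mem) (k : Stk) (x : List Letter) : Mem :=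
  match k with
  | .inp => { s with inp := x }
  | .out => { s with out := x }
  | .nn => { s with nn := x }
  | .kk => { s with kk := x }
  | .nd => { s with nd := x }
  | .os => { s with os := x }
  | .nr => { s with nr := x }
  | .orr => { s with orr := x }
  | .bk => { s with bk := x }
  | .t1 => { s with t1 := x }
  | .t2 => { s with t2 := x }
  | .tm => { s with tm := x }
  | .dv => { s with dv := x }
  | .dp => { s with dp := x }
  | .cc => { s with cc := x }

attribute [simp] get.eq_1 get.eq_2 get.eq_3 get.eq_4 get.eq_5 get.eq_6 get.eq_7 get.eq_8
  get.eq_9 get.eq_10 get.eq_11 get.eq_12 get.eq_13 get.eq_14 get.eq_15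

attribute [simp] set.eq_1 set.eq_2 set.eq_3 set.eq_4 set.eq_5 set.eq_6 set.eq_7 set.eq_8
  set.eq_9 set.eq_10 set.eq_11 set.eq_12 set.eq_13 set.eq_14 set.eq_15

theorem get_set (s : Mem) (k : Stk) (x : List Letter) :
    (s.set k x).get = Function.update s.get k x := by
  funext j
  cases k <;> cases j <;> rfl

/-- Named fields make specifications readable, while the machine needs a function of the stack.
Equalities of memories are checked stack by stack through this lemma, after `get_set` has turned
every update into `Function.update`. -/
theorem get_injective {s s' : Mem} (h : s.get = s'.get) : s = s' := by
  ext1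
  exacts [congrFun h .inp, congrFun h .out, congrFun h .nn, congrFun h .kk, congrFun h .nd,
    congrFun h .os, congrFun h .nr, congrFun h .orr, congrFun h .bk, congrFun h .t1,
    congrFun h .t2, congrFun h .tm, congrFun h .dv, congrFun h .dp, congrFun h .cc]

theorem get_set_self (s : Mem) (k : Stk) (x : List Letter) : (s.set k x).get k = x := by
  rw [get_set, Function.update_self]

theorem get_set_of_ne (s : Mem) {k j : Stk} (h : j ≠ k) (x : List Letter) :
    (s.set k x).get j = s.get j := by
  rw [get_set, Function.update_of_ne h]

theorem set_set (s : Mem) (k : Stk) (x y : List Letter) : (s.set k x).set k y = s.set k y := by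
  cases k <;> rfl

theorem set_comm (s : Mem) {k j : Stk} (h : k ≠ j) (x y : List Letter) :
    (s.set k x).set j y = (s.set j y).set k x := by
  apply get_injective
  simp only [get_set, Function.update_comm h]

theorem set_get (s : Mem) (k : Stk) : s.set k (s.get k) = s := by
  cases k <;> rfl

end Mem

/-- Structured stack programs. -/
inductive Prog : Type
  | skip
  | push (k : Stk) (a : Letter)
  | copyTop (i j : Stk)
  | pop (k : Stk)
  | seq (p q : Prog)
  | ite (k : Stk) (c : Option Letter → Bool) (p q : Prog)
  | loop (k : Stk) (c : Option Letter → Bool) (p : Prog)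

namespace Prog

infixr:60 " ;; " => Prog.seq

/-- The labels of the machine code of a program. -/
def Lab : Prog → Type
  | skip => Unit
  | push _ _ => Unit
  | copyTop _ _ => Unit
  | pop _ => Unit
  | seq p q => Lab p ⊕ Lab q
  | ite _ _ p q => Option (Lab p ⊕ Lab q)
  | loop _ _ p => Option (Lab p)

/-- The label at which the code of a program starts. -/
def entry : (p : Prog) → p.Lab
  | skip => ()
  | push _ _ => ()
  | copyTop _ _ => ()
  | pop _ => ()
  | seq p _ => Sum.inl (entry p)
  | ite _ _ _ _ => (none : Option _)
  | loop _ _ _ => (none : Option _)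

instance fintypeLab : (p : Prog) → Fintype p.Lab
  | skip => inferInstanceAs (Fintype Unit)
  | push _ _ => inferInstanceAs (Fintype Unit)
  | copyTop _ _ => inferInstanceAs (Fintype Unit)
  | pop _ => inferInstanceAs (Fintype Unit)
  | seq p q =>
    letI := fintypeLab p
    letI := fintypeLab q
    inferInstanceAs (Fintype (Lab p ⊕ Lab q))
  | ite _ _ p q =>
    letI := fintypeLab p
    letI := fintypeLab q
    inferInstanceAs (Fintype (Option (Lab p ⊕ Lab q)))
  | loop _ _ p =>
    letI := fintypeLab p
    inferInstanceAs (Fintype (Option (Lab p)))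

open Turing.TM2 in
/-- The machine code of a program inside a machine with labels `Λ`: the labels of the program are
placed by `ι`, and control leaves for the label `e`. The internal state holds the letter that was
read last. -/
def code {Λ : Type} : (p : Prog) → (p.Lab → Λ) → Λ → p.Lab →
    Stmt (fun _ : Stk => Letter) Λ (Option Letter)
  | skip, _, e, _ => .goto fun _ => e
  | push k a, _, e, _ => .push k (fun _ => a) (.goto fun _ => e)
  | copyTop i j, _, e, _ =>
    .peek i (fun _ o => o) (.push j (fun v => v.getD .tick) (.goto fun _ => e))
  | pop k, _, e, _ => .pop k (fun v _ => v) (.goto fun _ => e)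
  | seq p q, ι, e, l =>
    match l with
    | Sum.inl l => code p (fun x => ι (Sum.inl x)) (ι (Sum.inr q.entry)) l
    | Sum.inr l => code q (fun x => ι (Sum.inr x)) e l
  | ite k c p q, ι, e, l =>
    match l with
    | none => .peek k (fun _ o => o) (.branch c
        (.goto fun _ => ι (some (Sum.inl p.entry))) (.goto fun _ => ι (some (Sum.inr q.entry))))
    | some (Sum.inl l) => code p (fun x => ι (some (Sum.inl x))) e l
    | some (Sum.inr l) => code q (fun x => ι (some (Sum.inr x))) e l
  | loop k c p, ι, e, l =>
    match l with
    | none => .peek k (fun _ o => o) (.branch c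
        (.goto fun _ => ι (some p.entry)) (.goto fun _ => e))
    | some l => code p (fun x => ι (some x)) (ι none) l

end Prog

/-- The machine `M` goes from configuration `c` to configuration `c'` in at most `t` steps. -/
def StepsIn {Λ : Type} (M : Λ → Turing.TM2.Stmt (fun _ : Stk => Letter) Λ (Option Letter))
    (c c' : Turing.TM2.Cfg (fun _ : Stk => Letter) Λ (Option Letter)) (t : ℕ) : Prop :=
  ∃ t' ≤ t, (flip bind (Turing.TM2.step M))^[t'] (some c) = some c'

theorem StepsIn.trans {Λ : Type}
    {M : Λ → Turing.TM2.Stmt (fun _ : Stk => Letter) Λ (Option Letter)}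
    {c c' c'' : Turing.TM2.Cfg (fun _ : Stk => Letter) Λ (Option Letter)} {t u : ℕ}
    (h : StepsIn M c c' t) (h' : StepsIn M c' c'' u) : StepsIn M c c'' (t + u) := by
  obtain ⟨i, hi, ei⟩ := h
  obtain ⟨j, hj, ej⟩ := h'
  exact ⟨j + i, by omega, by rw [Function.iterate_add_apply, ei, ej]⟩

theorem StepsIn.single {Λ : Type}
    {M : Λ → Turing.TM2.Stmt (fun _ : Stk => Letter) Λ (Option Letter)}
    {l : Λ} {v : Option Letter} {S : Stk → List Letter}
    {c : Turing.TM2.Cfg (fun _ : Stk => Letter) Λ (Option Letter)}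
    (h : Turing.TM2.stepAux (M l) v S = c) : StepsIn M ⟨some l, v, S⟩ c 1 :=
  ⟨1, le_rfl, by subst h; rfl⟩

/-- Program `p` leads from memory `s` to memory `s'` in at most `t` machine steps, wherever its
code is placed. -/
def Runs (p : Prog) (s s' : Mem) (t : ℕ) : Prop :=
  ∀ (Λ : Type) (M : Λ → Turing.TM2.Stmt (fun _ : Stk => Letter) Λ (Option Letter))
    (ι : p.Lab → Λ) (e : Λ), (∀ l, M (ι l) = p.code ι e l) → ∀ v : Option Letter,
    ∃ v', StepsIn M ⟨some (ι p.entry), v, s.get⟩ ⟨some e, v', s'.get⟩ t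

namespace Runs

open Prog

theorem mono {p : Prog} {s s' : Mem} {t u : ℕ} (h : Runs p s s' t) (htu : t ≤ u) :
    Runs p s s' u := by
  intro Λ M ι e hM v
  obtain ⟨v', i, hi, ei⟩ := h Λ M ι e hM v
  exact ⟨v', i, hi.trans htu, ei⟩

theorem skip (s : Mem) : Runs .skip s s 1 := by
  intro Λ M ι e hM v
  exact ⟨v, .single (by rw [hM]; rfl)⟩

theorem push (k : Stk) (a : Letter) (s : Mem) : Runs (.push k a) s (s.set k (a :: s.get k)) 1 := by
  intro Λ M ι e hM v
  exact ⟨v, .single (by rw [hM, Mem.get_set]; rfl)⟩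

/-- The source is nonempty, so the default letter `.tick` in `code` is never the one that is pushed.
-/
theorem copyTop {i : Stk} (j : Stk) {a : Letter} {x : List Letter} {s : Mem}
    (h : s.get i = a :: x) : Runs (.copyTop i j) s (s.set j (a :: s.get j)) 1 := by
  intro Λ M ι e hM v
  refine ⟨some a, .single ?_⟩
  rw [hM, Mem.get_set]
  simp [code, h]

theorem pop {k : Stk} {a : Letter} {x : List Letter} {s : Mem}
    (h : s.get k = a :: x) : Runs (.pop k) s (s.set k x) 1 := by
  intro Λ M ι e hM v
  refine ⟨v, .single ?_⟩
  rw [hM, Mem.get_set]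
  simp [code, h]

theorem seq {p q : Prog} {s s' s'' : Mem} {t u : ℕ} (hp : Runs p s s' t) (hq : Runs q s' s'' u) :
    Runs (p ;; q) s s'' (t + u) := by
  intro Λ M ι e hM v
  obtain ⟨v', h1⟩ := hp Λ M (fun x => ι (Sum.inl x)) (ι (Sum.inr q.entry)) (fun l => hM (.inl l)) v
  obtain ⟨v'', h2⟩ := hq Λ M (fun x => ι (Sum.inr x)) e (fun l => hM (.inr l)) v'
  exact ⟨v'', h1.trans h2⟩

theorem ite_true {k : Stk} {c : Option Letter → Bool} {p q : Prog} {s s' : Mem} {t : ℕ}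
    (h : c (s.get k).head? = true) (hp : Runs p s s' t) : Runs (.ite k c p q) s s' (1 + t) := by
  intro Λ M ι e hM v
  obtain ⟨v', h1⟩ := hp Λ M (fun x => ι (some (Sum.inl x))) e (fun l => hM (some (.inl l)))
    (s.get k).head?
  refine ⟨v', StepsIn.trans (.single ?_) h1⟩
  rw [hM]
  simp [code, entry, h]

theorem ite_false {k : Stk} {c : Option Letter → Bool} {p q : Prog} {s s' : Mem} {t : ℕ}
    (h : c (s.get k).head? = false) (hq : Runs q s s' t) : Runs (.ite k c p q) s s' (1 + t) := by
  intro Λ M ι e hM v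
  obtain ⟨v', h1⟩ := hq Λ M (fun x => ι (some (Sum.inr x))) e (fun l => hM (some (.inr l)))
    (s.get k).head?
  refine ⟨v', StepsIn.trans (.single ?_) h1⟩
  rw [hM]
  simp [code, entry, h]

theorem loop_done {k : Stk} {c : Option Letter → Bool} {p : Prog} {s : Mem}
    (h : c (s.get k).head? = false) : Runs (.loop k c p) s s 1 := by
  intro Λ M ι e hM v
  refine ⟨(s.get k).head?, .single ?_⟩
  rw [hM]
  simp [code, entry, h]

/-- The code of the body exits to the test label, which is the entry of the loop itself. Loops are
therefore verified by induction, with `loop_done` as the base case. -/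
theorem loop_step {k : Stk} {c : Option Letter → Bool} {p : Prog} {s s' s'' : Mem} {t u : ℕ}
    (h : c (s.get k).head? = true) (hp : Runs p s s' t) (hl : Runs (.loop k c p) s' s'' u) :
    Runs (.loop k c p) s s'' (1 + t + u) := by
  intro Λ M ι e hM v
  obtain ⟨v', h1⟩ := hp Λ M (fun x => ι (some x)) (ι none) (fun l => hM (some l)) (s.get k).head?
  obtain ⟨v'', h2⟩ := hl Λ M ι e hM v'
  refine ⟨v'', StepsIn.trans (StepsIn.trans (.single ?_) h1) h2⟩
  rw [hM]
  simp [code, entry, h]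

theorem of_eq {p : Prog} {s s' s'' : Mem} {t u : ℕ} (h : Runs p s s' t) (hs : s' = s'')
    (htu : t ≤ u) : Runs p s s'' u := hs ▸ h.mono htu

end Runs

/-- The machine that runs a program and halts. -/
def Prog.machine (p : Prog) : Turing.FinTM2 where
  K := Stk
  k₀ := .inp
  k₁ := .out
  Γ := fun _ => Letter
  Λ := Option p.Lab
  main := some p.entry
  σ := Option Letter
  initialState := none
  m := fun l =>
    match l with
    -- `Turing.haltList` requires the initial internal state, so the letter read last is erased
    -- before halting.
    | none => .load (fun _ => none) .halt
    | some l => p.code some none l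

/-- A function is computed in polynomial time if a program computes it in polynomial time. -/
theorem polyTime_of_runs {α β : Type} {ea : α → List Letter} {eb : β → List Letter} {f : α → β}
    (p : Prog) (T : Polynomial ℕ)
    (h : ∀ a, Runs p { inp := ea a } { out := eb (f a) } (T.eval (ea a).length)) :
    PolyTime ea eb f := by
  -- The additional step is the halting step at label `none`.
  refine ⟨⟨⟨p.machine, Equiv.refl _, Equiv.refl _⟩, T + 1, fun a => Classical.choice ?_⟩⟩
  obtain ⟨v', h1⟩ := h a (Option p.Lab) p.machine.m some none (fun l => rfl) none
  have h2 : StepsIn p.machine.m ⟨some none, v', ({ out := eb (f a) } : Mem).get⟩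
      ⟨none, none, ({ out := eb (f a) } : Mem).get⟩ 1 := .single rfl
  obtain ⟨i, hi, ei⟩ := h1.trans h2
  refine ⟨⟨⟨i, ?_⟩, by simpa using hi⟩⟩
  have e1 : Turing.initList p.machine (List.map (Equiv.refl Letter).invFun (ea a)) =
      ⟨some (some p.entry), none, ({ inp := ea a } : Mem).get⟩ := by
    unfold Turing.initList
    congr 1
    funext k
    cases k <;> simp [Prog.machine]
    rfl
  have e2 : Turing.haltList p.machine (List.map (Equiv.refl Letter).invFun (eb (f a))) =
      ⟨none, none, ({ out := eb (f a) } : Mem).get⟩ := by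
    unfold Turing.haltList
    congr 1
    funext k
    cases k <;> simp [Prog.machine]
    rfl
  rw [Option.map_some]
  erw [e1, e2]
  exact ei

/-! ### Elementary programs -/

/-- The test for a given top letter. -/
def isTop (a : Letter) : Option Letter → Bool := fun o => decide (o = some a)

/-- The test for a letter that opens the encoding of a node. -/
def opensNode : Option Letter → Bool
  | some .tt => true
  | some .ff => true
  | some .var => true
  | some .not => true
  | some .and => true
  | some .or => true
  | _ => false

/-- The test for a letter that encodes a constant. -/
def isConst : Option Letter → Bool
  | some .tt => true
  | some .ff => true
  | _ => false

namespace Prog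

def pushList (k : Stk) : List Letter → Prog
  | [] => skip
  | a :: l => push k a ;; pushList k l

/-- Empty a stack. -/
def clear (k : Stk) : Prog := loop k Option.isSome (pop k)

/-- Move the top letter of `i` to `j`. -/
def move (i j : Stk) : Prog := copyTop i j ;; pop i

/-- Move the top letter of `i` to both `j` and `k`. -/
def fork (i j k : Stk) : Prog := copyTop i j ;; copyTop i k ;; pop i

/-- Move the contents of `i` to `j`, which reverses their order. -/
def moveAll (i j : Stk) : Prog := loop i Option.isSome (move i j)

/-- Add the counter `d` on top of `j`, keeping `d`. -/
def addCounter (d j : Stk) : Prog := loop d Option.isSome (fork d j .tm) ;; moveAll .tm d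

/-- Read a number from `src`, write it to `dst` increased by the counter `d`, and keep a copy. -/
def shiftNum (src dst d : Stk) : Prog :=
  loop src (isTop .tick) (fork src dst .bk) ;; addCounter d dst ;; fork src dst .bk

/-- Read a list of nodes from `src` and write it to `nr`, shifted by the counters `dv` (variables)
and `dp` (positions), keep a copy, and count the nodes. -/
def copyNodes (src : Stk) : Prog :=
  loop src opensNode (push .cc .tick ;;
    ite src isConst (fork src .nr .bk)
    (ite src (isTop .var) (fork src .nr .bk ;; shiftNum src .nr .dv)
    (ite src (isTop .not) (fork src .nr .bk ;; shiftNum src .nr .dp)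
      (fork src .nr .bk ;; shiftNum src .nr .dp ;; shiftNum src .nr .dp))))

/-- Read a list of outputs from `src` and write it to `orr`, shifted by the counter `dp`, and keep
a copy. -/
def copyOuts (src : Stk) : Prog :=
  loop src (isTop .out) (fork src .orr .bk ;; shiftNum src .orr .dp)

end Prog

/-- A node with its variable and its positions shifted. -/
def Node.shift {n n' : ℕ} (v d : ℕ) (h : n + v ≤ n') : Node n → Node n'
  | var i => var ⟨i + v, by omega⟩
  | const c => const c
  | not p => not (p + d)
  | and p q => and (p + d) (q + d)
  | or p q => or (p + d) (q + d)

/-- A counter. -/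
abbrev ticks (k : ℕ) : List Letter := List.replicate k .tick

/-- The encoding of a list of output positions. -/
def encodeOuts (L : List ℕ) : List Letter := L.flatMap fun p => Letter.out :: encodeUnary p

/-! ### Effect and running time of the elementary programs -/

namespace Runs

open Prog

theorem pushList (k : Stk) (l : List Letter) (s : Mem) :
    Runs (.pushList k l) s (s.set k (l.reverse ++ s.get k)) (l.length + 1) := by
  induction l generalizing s with
  | nil => simpa [Prog.pushList, Mem.set_get] using skip s
  | cons a l ih =>
    refine ((push k a s).seq (ih _)).of_eq ?_ (by simp; omega)
    simp [Mem.get_set_self, Mem.set_set]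

theorem clear (k : Stk) (s : Mem) : Runs (.clear k) s (s.set k []) (2 * (s.get k).length + 1) := by
  generalize hl : s.get k = l
  induction l generalizing s with
  | nil => exact (loop_done (by simp [hl])).of_eq (by rw [← hl, Mem.set_get]) (by omega)
  | cons a l ih =>
    refine (loop_step (by simp [hl]) (pop hl) (ih _ (Mem.get_set_self ..))).of_eq ?_
      (by simp; omega)
    rw [Mem.set_set]

theorem move {i j : Stk} (hij : i ≠ j) {a : Letter} {x : List Letter} {s : Mem}
    (h : s.get i = a :: x) : Runs (.move i j) s ((s.set j (a :: s.get j)).set i x) 2 :=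
  (copyTop j h).seq (pop (by rw [Mem.get_set_of_ne _ hij, h]))

theorem fork {i j k : Stk} (hij : i ≠ j) (hik : i ≠ k) (hjk : j ≠ k) {a : Letter}
    {x : List Letter} {s : Mem} (h : s.get i = a :: x) :
    Runs (.fork i j k) s (((s.set j (a :: s.get j)).set k (a :: s.get k)).set i x) 3 := by
  refine ((copyTop j h).seq ((copyTop (x := x) (a := a) k ?_).seq
    (pop (a := a) (x := x) ?_))).of_eq ?_ le_rfl
  · rw [Mem.get_set_of_ne _ hij, h]
  · rw [Mem.get_set_of_ne _ hik, Mem.get_set_of_ne _ hij, h]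
  · rw [Mem.get_set_of_ne _ hjk.symm]

/-- The splitting `l ++ x` marks where the test first fails, so one statement covers both emptying a
stack and reading the ticks of a unary number up to its comma. -/
theorem loop_move {i j : Stk} (hij : i ≠ j) {c : Option Letter → Bool} {l x : List Letter}
    {s : Mem} (h : s.get i = l ++ x) (hl : ∀ a ∈ l, c (some a) = true)
    (hx : c x.head? = false) :
    Runs (.loop i c (.move i j)) s ((s.set j (l.reverse ++ s.get j)).set i x)
      (3 * l.length + 1) := by
  induction l generalizing s with
  | nil =>
    refine (loop_done (by rw [h]; exact hx)).of_eq ?_ (by omega)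
    apply Mem.get_injective
    funext k
    simp only [Mem.get_set, Function.update_apply]
    grind
  | cons a l ih =>
    refine (loop_step (by rw [h]; exact hl a (by simp)) (move hij (x := l ++ x) (by simpa using h))
      (ih (Mem.get_set_self ..) fun b hb => hl b (by simp [hb]))).of_eq ?_ (by simp; omega)
    apply Mem.get_injective
    funext k
    simp only [Mem.get_set, Function.update_apply]
    grind

theorem loop_fork {i j k : Stk} (hij : i ≠ j) (hik : i ≠ k) (hjk : j ≠ k)
    {c : Option Letter → Bool} {l x : List Letter} {s : Mem} (h : s.get i = l ++ x)
    (hl : ∀ a ∈ l, c (some a) = true) (hx : c x.head? = false) :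
    Runs (.loop i c (.fork i j k)) s
      (((s.set j (l.reverse ++ s.get j)).set k (l.reverse ++ s.get k)).set i x)
      (4 * l.length + 1) := by
  induction l generalizing s with
  | nil =>
    refine (loop_done (by rw [h]; exact hx)).of_eq ?_ (by omega)
    apply Mem.get_injective
    funext k
    simp only [Mem.get_set, Function.update_apply]
    grind
  | cons a l ih =>
    refine (loop_step (by rw [h]; exact hl a (by simp))
      (fork hij hik hjk (x := l ++ x) (by simpa using h))
      (ih (Mem.get_set_self ..) fun b hb => hl b (by simp [hb]))).of_eq ?_ (by simp; omega)
    apply Mem.get_injective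
    funext k
    simp only [Mem.get_set, Function.update_apply]
    grind

theorem moveAll {i j : Stk} (hij : i ≠ j) (s : Mem) :
    Runs (.moveAll i j) s ((s.set j ((s.get i).reverse ++ s.get j)).set i [])
      (3 * (s.get i).length + 1) :=
  loop_move hij (by simp) (by simp) (by simp)

theorem moveTicks {i j : Stk} (hij : i ≠ j) {p : ℕ} {a : Letter} {x : List Letter} {s : Mem}
    (h : s.get i = ticks p ++ a :: x) (ha : a ≠ .tick) :
    Runs (.loop i (isTop .tick) (.move i j)) s ((s.set j (ticks p ++ s.get j)).set i (a :: x))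
      (3 * p + 1) := by
  refine (loop_move hij h ?_ ?_).of_eq (by simp) (by simp)
  · simp [isTop]
  · simpa [isTop] using ha

/-- The counter is drained into both `j` and `tm` and refilled from `tm`, which must therefore start
empty. The reversals are invisible because all letters are ticks. -/
theorem addCounter {d j : Stk} (hdj : d ≠ j) (hd : d ≠ .tm) (hj : j ≠ .tm) {n : ℕ} {s : Mem}
    (h : s.get d = ticks n) (ht : s.tm = []) :
    Runs (.addCounter d j) s (s.set j (ticks n ++ s.get j)) (7 * n + 2) := by
  refine ((loop_fork hdj hd hj (by rw [h, List.append_nil]) (by simp) (by simp)).seq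
    (moveAll hd.symm _)).of_eq ?_ ?_
  · replace ht : s.get .tm = [] := ht
    apply Mem.get_injective
    funext k
    simp only [Mem.get_set, Function.update_apply]
    grind
  · replace ht : s.get .tm = [] := ht
    simp [Mem.get_set_of_ne _ hd.symm, ht]
    omega

/-- The ticks of `d` are inserted before the comma is copied, so `dst` receives `p + e` while the
backup receives `p`. Both appear reversed, as the top of a stack is the head of the list. -/
theorem shiftNum {src dst d : Stk} (hn : [src, dst, d, .bk, .tm].Nodup) {p e : ℕ}
    {x : List Letter} {s : Mem} (h : s.get src = encodeUnary p ++ x) (hd : s.get d = ticks e)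
    (ht : s.tm = []) :
    Runs (.shiftNum src dst d) s
      (((s.set dst ((encodeUnary (p + e)).reverse ++ s.get dst)).set .bk
        ((encodeUnary p).reverse ++ s.bk)).set src x) (4 * p + 7 * e + 6) := by
  replace ht : s.get .tm = [] := ht
  have hb : s.bk = s.get .bk := rfl
  simp only [List.nodup_cons, List.mem_cons, List.not_mem_nil, or_false, not_or,
    List.nodup_nil, and_true, not_false_eq_true] at hn
  obtain ⟨⟨n1, n2, n3, n4⟩, ⟨n5, n6, n7⟩, ⟨n8, n9⟩, n10⟩ := hn
  have h' : s.get src = ticks p ++ (.comma :: x) := by rw [h]; simp [encodeUnary]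
  refine ((loop_fork n1 n3 n6 h' (by simp [isTop]) (by simp [isTop])).seq
    ((addCounter (n := e) (Ne.symm n5) n9 n7 ?_ ?_).seq
    (fork (a := .comma) (x := x) n1 n3 n6 ?_))).of_eq ?_ (by simp; omega)
  · simp only [Mem.get_set, Function.update_apply]
    grind
  · change Mem.get _ .tm = []
    simp only [Mem.get_set, Function.update_apply]
    grind
  · simp only [Mem.get_set, Function.update_apply]
    grind
  · have hr : (encodeUnary (p + e)).reverse = .comma :: (ticks e ++ ticks p) := by
      simp [encodeUnary, Nat.add_comm]
    have hr' : (encodeUnary p).reverse = .comma :: ticks p := by simp [encodeUnary]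
    rw [hr, hr', hb]
    apply Mem.get_injective
    funext k
    simp only [Mem.get_set, Function.update_apply]
    grind

end Runs

/-! ### Copying and shifting nodes and outputs -/

namespace Runs

open Prog

/-- One pass of the loop in `copyNodes`. The first letter determines the kind of the node, hence how
many numbers follow and whether they are shifted by `dv` or by `dp`. -/
theorem copyNode {src : Stk} (hn : [src, .nr, .dv, .dp, .bk, .tm, .cc].Nodup) {n n' v d : ℕ}
    (hv : n + v ≤ n') (g : Node n) {x : List Letter} {s : Mem}
    (h : s.get src = encodeNode g ++ x) (hdv : s.dv = ticks v) (hdp : s.dp = ticks d)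
    (ht : s.tm = []) :
    Runs (.push .cc .tick ;;
      .ite src isConst (.fork src .nr .bk)
      (.ite src (isTop .var) (.fork src .nr .bk ;; .shiftNum src .nr .dv)
      (.ite src (isTop .not) (.fork src .nr .bk ;; .shiftNum src .nr .dp)
        (.fork src .nr .bk ;; .shiftNum src .nr .dp ;; .shiftNum src .nr .dp)))) s
      ((((s.set .cc (.tick :: s.cc)).set .nr
        ((encodeNode (g.shift v d hv)).reverse ++ s.nr)).set .bk
        ((encodeNode g).reverse ++ s.bk)).set src x)
      (4 * (encodeNode g).length + 14 * (v + d) + 20) := by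
  replace ht : s.get .tm = [] := ht
  replace hdv : s.get .dv = ticks v := hdv
  replace hdp : s.get .dp = ticks d := hdp
  have e1 : s.bk = s.get .bk := rfl
  have e2 : s.nr = s.get .nr := rfl
  have e3 : s.cc = s.get .cc := rfl
  rw [e1, e2, e3]
  have m1 : [src, .nr, .dv, .bk, .tm].Nodup := by
    revert hn; cases src <;> decide
  have m2 : [src, .nr, .dp, .bk, .tm].Nodup := by
    revert hn; cases src <;> decide
  have n1 : src ≠ .nr := by rintro rfl; revert hn; decide
  have n2 : src ≠ .bk := by rintro rfl; revert hn; decide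
  have n3 : src ≠ .cc := by rintro rfl; revert hn; decide
  have n4 : src ≠ .tm := by rintro rfl; revert hn; decide
  have n5 : src ≠ .dv := by rintro rfl; revert hn; decide
  have n6 : src ≠ .dp := by rintro rfl; revert hn; decide
  have hp : ∀ t, (s.set .cc t).get src = s.get src := fun t => Mem.get_set_of_ne _ n3 t
  have fk : ∀ {a x' t}, s.get src = a :: x' → Runs (.fork src .nr .bk) (s.set .cc t) _ _ :=
    fun {a x' t} h => fork n1 n2 (by decide) (a := a) (x := x') (by rw [hp, h])
  rcases g with i | (_ | _) | p | ⟨p, q⟩ | ⟨p, q⟩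
  · simp only [encodeNode, List.cons_append] at h
    refine ((push _ _ s).seq (ite_false (by rw [hp, h]; rfl) (ite_true (by rw [hp, h]; rfl)
      ((fk h).seq (shiftNum m1 (x := x) (p := i) (e := v) ?_ ?_ ?_))))).of_eq ?_ ?_
    · simp only [Mem.get_set, Function.update_apply]
      grind
    · simp only [Mem.get_set, Function.update_apply]
      grind
    · change Mem.get _ .tm = []
      simp only [Mem.get_set, Function.update_apply]
      grind
    -- The field projection is folded back into `Mem.get`, the form in which `Mem.get_set` rewrites.
    · change Mem.set (Mem.set _ _ (_ ++ Mem.get _ .bk)) _ _ = _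
      simp only [encodeNode, Node.shift]
      apply Mem.get_injective
      funext k
      simp only [Mem.get_set, Function.update_apply]
      grind
    · simp [encodeNode, encodeUnary]; omega
  · simp only [encodeNode, List.cons_append, List.nil_append] at h
    refine ((push _ _ s).seq (ite_true (by rw [hp, h]; rfl) (fk h))).of_eq ?_ ?_
    · simp only [encodeNode, Node.shift]
      apply Mem.get_injective
      funext k
      simp only [Mem.get_set, Function.update_apply]
      grind
    · simp [encodeNode]
  · simp only [encodeNode, List.cons_append, List.nil_append] at h
    refine ((push _ _ s).seq (ite_true (by rw [hp, h]; rfl) (fk h))).of_eq ?_ ?_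
    · simp only [encodeNode, Node.shift]
      apply Mem.get_injective
      funext k
      simp only [Mem.get_set, Function.update_apply]
      grind
    · simp [encodeNode]
  · simp only [encodeNode, List.cons_append] at h
    refine ((push _ _ s).seq (ite_false (by rw [hp, h]; rfl)
      (ite_false (by rw [hp, h]; rfl) (ite_true (by rw [hp, h]; rfl)
      ((fk h).seq (shiftNum m2 (x := x) (p := p) (e := d) ?_ ?_ ?_)))))).of_eq ?_ ?_
    · simp only [Mem.get_set, Function.update_apply]
      grind
    · simp only [Mem.get_set, Function.update_apply]
      grind
    · change Mem.get _ .tm = []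
      simp only [Mem.get_set, Function.update_apply]
      grind
    · change Mem.set (Mem.set _ _ (_ ++ Mem.get _ .bk)) _ _ = _
      simp only [encodeNode, Node.shift]
      apply Mem.get_injective
      funext k
      simp only [Mem.get_set, Function.update_apply]
      grind
    · simp [encodeNode, encodeUnary]; omega
  all_goals
    simp only [encodeNode, List.cons_append, List.append_assoc] at h
    refine ((push _ _ s).seq (ite_false (by rw [hp, h]; rfl)
      (ite_false (by rw [hp, h]; rfl) (ite_false (by rw [hp, h]; rfl)
      ((fk h).seq ((shiftNum m2 (x := encodeUnary q ++ x) (p := p) (e := d) ?_ ?_ ?_).seq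
        (shiftNum m2 (x := x) (p := q) (e := d) ?_ ?_ ?_))))))).of_eq ?_ ?_
    · simp only [Mem.get_set, Function.update_apply]
      grind
    · simp only [Mem.get_set, Function.update_apply]
      grind
    · change Mem.get _ .tm = []
      simp only [Mem.get_set, Function.update_apply]
      grind
    · simp only [Mem.get_set, Function.update_apply]
      grind
    · simp only [Mem.get_set, Function.update_apply]
      grind
    · change Mem.get _ .tm = []
      simp only [Mem.get_set, Function.update_apply]
      grind
    · change Mem.set (Mem.set _ _ (_ ++ Mem.get (Mem.set (Mem.set _ _ (_ ++ Mem.get _ .bk)) _ _)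
        .bk)) _ _ = _
      simp only [encodeNode, Node.shift]
      apply Mem.get_injective
      funext k
      simp only [Mem.get_set, Function.update_apply]
      grind
    · simp [encodeNode, encodeUnary]; omega

theorem opensNode_encodeNode {n : ℕ} (g : Node n) (x : List Letter) :
    opensNode (encodeNode g ++ x).head? = true := by
  rcases g with i | (_ | _) | p | ⟨p, q⟩ | ⟨p, q⟩ <;> rfl

theorem copyNodes {src : Stk} (hn : [src, .nr, .dv, .dp, .bk, .tm, .cc].Nodup) {n n' v d : ℕ}
    (hv : n + v ≤ n') (L : List (Node n)) {x : List Letter} {s : Mem}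
    (h : s.get src = L.flatMap encodeNode ++ x) (hx : opensNode x.head? = false)
    (hdv : s.dv = ticks v) (hdp : s.dp = ticks d) (ht : s.tm = []) :
    Runs (.copyNodes src) s
      ((((s.set .cc (ticks L.length ++ s.cc)).set .nr
        (((L.map (Node.shift v d hv)).flatMap encodeNode).reverse ++ s.nr)).set .bk
        ((L.flatMap encodeNode).reverse ++ s.bk)).set src x)
      (4 * (L.flatMap encodeNode).length + L.length * (14 * (v + d) + 21) + 1) := by
  have n1 : src ≠ .nr := by rintro rfl; revert hn; decide
  have n2 : src ≠ .bk := by rintro rfl; revert hn; decide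
  have n3 : src ≠ .cc := by rintro rfl; revert hn; decide
  have n4 : src ≠ .tm := by rintro rfl; revert hn; decide
  have n5 : src ≠ .dv := by rintro rfl; revert hn; decide
  have n6 : src ≠ .dp := by rintro rfl; revert hn; decide
  induction L generalizing s with
  | nil =>
    refine (loop_done (by rw [h]; exact hx)).of_eq ?_ (by simp)
    change s = (((s.set _ (_ ++ s.get .cc)).set _ (_ ++ s.get .nr)).set _ (_ ++ s.get .bk)).set _ _
    apply Mem.get_injective
    funext k
    simp only [Mem.get_set, Function.update_apply]
    grind
  | cons g L ih =>
    simp only [List.flatMap_cons, List.append_assoc] at h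
    refine (loop_step (by rw [h]; exact opensNode_encodeNode g _)
      (copyNode hn hv g h hdv hdp ht) (ih (Mem.get_set_self ..) ?_ ?_ ?_)).of_eq ?_ ?_
    · change Mem.get _ .dv = _
      simp only [Mem.get_set, Function.update_apply]
      simpa [n5.symm] using hdv
    · change Mem.get _ .dp = _
      simp only [Mem.get_set, Function.update_apply]
      simpa [n6.symm] using hdp
    · change Mem.get _ .tm = _
      simp only [Mem.get_set, Function.update_apply]
      simpa [n4.symm] using ht
    · change (((Mem.set _ _ (_ ++ Mem.get _ .cc)).set _ (_ ++ Mem.get _ .nr)).set _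
        (_ ++ Mem.get _ .bk)).set _ _ = _
      apply Mem.get_injective
      funext k
      simp only [Mem.get_set, Function.update_apply]
      cases k <;> simp [n1.symm, n2.symm, n3.symm, n4.symm, n5.symm, n6.symm,
        List.replicate_succ'] <;> grind
    · simp only [List.flatMap_cons, List.length_append, List.length_cons]
      ring_nf
      omega

theorem copyOuts {src : Stk} (hn : [src, .orr, .dp, .bk, .tm].Nodup) {d : ℕ}
    (L : List ℕ) {x : List Letter} {s : Mem}
    (h : s.get src = encodeOuts L ++ x) (hx : isTop .out x.head? = false)
    (hdp : s.dp = ticks d) (ht : s.tm = []) :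
    Runs (.copyOuts src) s
      (((s.set .orr ((encodeOuts (L.map (· + d))).reverse ++ s.orr)).set .bk
        ((encodeOuts L).reverse ++ s.bk)).set src x)
      (4 * (encodeOuts L).length + L.length * (7 * d + 10) + 1) := by
  have n1 : src ≠ .orr := by rintro rfl; revert hn; decide
  have n2 : src ≠ .bk := by rintro rfl; revert hn; decide
  have n4 : src ≠ .tm := by rintro rfl; revert hn; decide
  have n6 : src ≠ .dp := by rintro rfl; revert hn; decide
  induction L generalizing s with
  | nil =>
    refine (loop_done (by rw [h]; exact hx)).of_eq ?_ (by simp)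
    replace h : s.get src = x := h
    change s = ((s.set _ (_ ++ s.get .orr)).set _ (_ ++ s.get .bk)).set _ _
    apply Mem.get_injective
    funext k
    simp only [Mem.get_set, Function.update_apply, encodeOuts]
    grind
  | cons p L ih =>
    simp only [encodeOuts, List.flatMap_cons, List.append_assoc, List.cons_append] at h
    refine (loop_step (by rw [h]; rfl) ((fork n1 n2 (by decide) h).seq
      (shiftNum (p := p) (e := d) (x := encodeOuts L ++ x) hn ?_ ?_ ?_))
      (ih (Mem.get_set_self ..) ?_ ?_)).of_eq ?_ ?_
    · simp [Mem.get_set, encodeOuts]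
    · simp only [Mem.get_set, Function.update_apply]
      simpa [n6.symm] using hdp
    · change Mem.get _ .tm = _
      simp only [Mem.get_set, Function.update_apply]
      simpa [n4.symm] using ht
    · change Mem.get _ .dp = _
      simp only [Mem.get_set, Function.update_apply]
      simpa [n6.symm] using hdp
    · change Mem.get _ .tm = _
      simp only [Mem.get_set, Function.update_apply]
      simpa [n4.symm] using ht
    · change ((Mem.set _ _ (_ ++ Mem.get _ .orr)).set _ (_ ++ Mem.get (Mem.set (Mem.set _ _
        (_ ++ Mem.get _ .bk)) _ _) .bk)).set _ _ = _
      apply Mem.get_injective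
      funext k
      simp only [Mem.get_set, Function.update_apply, encodeOuts]
      cases k <;> simp [n1.symm, n2.symm, n4.symm, n6.symm] <;> grind
    · simp only [encodeOuts, encodeUnary, List.flatMap_cons, List.length_append, List.length_cons,
        List.length_replicate, List.length_nil]
      ring_nf
      omega

end Runs

/-! ### Circuits with a selector -/

/-- Each node of the list, whose first node has position `k`, reads only earlier nodes. -/
def PredsLt {n : ℕ} : ℕ → List (Node n) → Prop
  | _, [] => True
  | k, g :: L => (∀ p ∈ g.preds, p < k) ∧ PredsLt (k + 1) L

namespace PredsLt

variable {n : ℕ}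

theorem append {k : ℕ} {L L' : List (Node n)} :
    PredsLt k (L ++ L') ↔ PredsLt k L ∧ PredsLt (k + L.length) L' := by
  induction L generalizing k with
  | nil => simp [PredsLt]
  | cons g L ih =>
    simp only [List.cons_append, PredsLt, ih, List.length_cons, and_assoc]
    rw [show k + 1 + L.length = k + (L.length + 1) by omega]

/-- Bridge between the recursive form, which suits concatenation, and the indexed form required by
`Circuit`. -/
theorem iff_getElem {k : ℕ} {L : List (Node n)} :
    PredsLt k L ↔ ∀ (j : ℕ) (hj : j < L.length), ∀ p ∈ (L[j]).preds, p < k + j := by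
  induction L generalizing k with
  | nil => simp [PredsLt]
  | cons g L ih =>
    simp only [PredsLt, ih, List.length_cons]
    constructor
    · rintro ⟨h1, h2⟩ (_ | j) hj p hp
      · exact h1 p hp
      · have := h2 j (by omega) p (by simpa using hp)
        omega
    · intro h
      refine ⟨fun p hp => by simpa using h 0 (by omega) p hp, fun j hj p hp => ?_⟩
      have := h (j + 1) (by omega) p (by simpa using hp)
      omega

theorem shift {n' k v d : ℕ} (hv : n + v ≤ n') {L : List (Node n)} (h : PredsLt k L) :
    PredsLt (k + d) (L.map (Node.shift v d hv)) := by
  induction L generalizing k with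
  | nil => trivial
  | cons g L ih =>
    refine ⟨?_, by simpa [Nat.add_right_comm] using ih h.2⟩
    have h1 := h.1
    rcases g with i | c | p | ⟨p, q⟩ | ⟨p, q⟩ <;> simp_all [Node.shift, Node.preds]

end PredsLt

/-- A circuit whose node at position `0` is left open for a selector bit: `body` are the nodes at
the positions from `1` on. -/
structure SelCircuit where
  n : ℕ
  m : ℕ
  body : List (Node n)
  outs : Fin m → ℕ
  predsLt : PredsLt 1 body
  outs_lt : ∀ o, outs o < body.length + 1

namespace SelCircuit

/-- The circuit obtained by fixing the selector. -/
def circuit (W : SelCircuit) (c : Bool) : Circuit W.n W.m where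
  nodes := Node.const c :: W.body
  outputs := W.outs
  preds_lt := by
    have h : PredsLt 0 (Node.const c :: W.body) := ⟨by simp [Node.preds], W.predsLt⟩
    simpa using PredsLt.iff_getElem.1 h
  outputs_lt := by simpa using W.outs_lt

def pair (W : SelCircuit) : CircuitPair := ⟨W.n, W.m, W.circuit false, W.circuit true⟩

/-- With the selector at position `0`, these nodes put a fresh random bit at position `1` and the
exclusive or of the two at position `5`. -/
def xorHeader (n : ℕ) : List (Node (n + n + 1)) :=
  [.var 0, .and 0 1, .not 2, .or 0 1, .and 3 4]

/-- The position of the selector of the first copy. -/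
def selA : Bool → ℕ
  | true => 1
  | false => 0

/-- The position of the selector of the second copy. -/
def selB : Bool → ℕ
  | true => 5
  | false => 0

/-- Two copies with independent inputs. If `x` is false, both have the given selector. If `x` is
true, the selector is split into the exclusive or of the selectors of the copies. -/
def double (x : Bool) (W : SelCircuit) : SelCircuit where
  n := W.n + W.n + 1
  m := W.m + W.m
  body := xorHeader W.n ++
    -- The gate `or p p` copies a bit to the place where a copy of the circuit expects its selector:
    -- position 6, behind the selector and the five header nodes, and position `W.body.length + 7`,
    -- behind the first copy. Input 0 is the random bit, whence the variable shifts `1` and `W.n +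
    -- 1`.
    (.or (selA x) (selA x) :: W.body.map (Node.shift 1 6 (by omega))) ++
    (.or (selB x) (selB x) :: W.body.map (Node.shift (W.n + 1) (W.body.length + 7) (by omega)))
  outs := Fin.append (fun o => W.outs o + 6) (fun o => W.outs o + (W.body.length + 7))
  predsLt := by
    simp only [PredsLt.append]
    refine ⟨⟨?_, ⟨?_, ?_⟩⟩, ⟨?_, ?_⟩⟩
    · simp [xorHeader, PredsLt, Node.preds]
    · cases x <;> simp [selA, xorHeader, Node.preds]
    · simpa [xorHeader, Nat.add_comm] using
        PredsLt.shift (v := 1) (d := 6) (n' := W.n + W.n + 1) (by omega) W.predsLt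
    · cases x <;> simp [selB, xorHeader, Node.preds]
      omega
    · have := PredsLt.shift (v := W.n + 1) (d := W.body.length + 7) (n' := W.n + W.n + 1)
        (by omega) W.predsLt
      convert this using 1
      simp [xorHeader]
      omega
  outs_lt := by
    intro o
    refine Fin.addCases (fun i => ?_) (fun i => ?_) o
    · have := W.outs_lt i
      simp [xorHeader]
      omega
    · have := W.outs_lt i
      rw [Fin.append_right]
      simp [xorHeader]
      omega

/-- The length of the encodings is polynomial in this number. -/
def size (W : SelCircuit) : ℕ := W.n + W.m + W.body.length

/-- One random input, five header gates and two copy gates account for the 8. Hence `size + 8` at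
most doubles, which is the form that is iterated. -/
theorem size_double (x : Bool) (W : SelCircuit) : (W.double x).size ≤ 2 * W.size + 8 := by
  simp [size, double, xorHeader]
  omega

theorem ofFn_double_outs (x : Bool) (W : SelCircuit) : List.ofFn (W.double x).outs =
    (List.ofFn W.outs).map (· + 6) ++ (List.ofFn W.outs).map (· + (W.body.length + 7)) := by
  simp only [double]
  rw [List.ofFn_fin_append]
  simp [Function.comp_def]

end SelCircuit

/-! ### Lengths of encodings -/

theorem length_encodeNode_le {n b : ℕ} (g : Node n) (h : ∀ p ∈ g.preds, p < b) :
    (encodeNode g).length ≤ n + 2 * b + 3 := by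
  rcases g with i | (_ | _) | p | ⟨p, q⟩ | ⟨p, q⟩ <;>
    simp [encodeNode, encodeUnary, Node.preds] at h ⊢ <;> omega

theorem length_flatMap_encodeNode_le {n k b : ℕ} {L : List (Node n)} (h : PredsLt k L)
    (hb : k + L.length ≤ b) : (L.flatMap encodeNode).length ≤ L.length * (n + 2 * b + 3) := by
  induction L generalizing k with
  | nil => simp
  | cons g L ih =>
    simp only [List.length_cons] at hb
    have h1 := length_encodeNode_le (b := b) g fun p hp => (h.1 p hp).trans_le (by omega)
    have h2 := ih h.2 (by omega)
    simp only [List.flatMap_cons, List.length_append, List.length_cons, Nat.add_mul]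
    omega

theorem length_encodeOuts_le {b : ℕ} {L : List ℕ} (h : ∀ p ∈ L, p < b) :
    (encodeOuts L).length ≤ L.length * (b + 2) := by
  induction L with
  | nil => simp [encodeOuts]
  | cons p L ih =>
    have h1 := ih fun q hq => h q (by simp [hq])
    have h2 := h p (by simp)
    simp only [encodeOuts, List.flatMap_cons, List.length_append, List.length_cons, encodeUnary,
      Nat.add_mul, List.length_replicate, List.length_nil] at h1 ⊢
    omega

/-- Positions are written in unary, so a single gate may cost linear length and the whole list
quadratic length. -/
theorem SelCircuit.length_body_le (W : SelCircuit) :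
    (W.body.flatMap encodeNode).length ≤ 5 * (W.size + 1) ^ 2 := by
  have h1 := length_flatMap_encodeNode_le W.predsLt le_rfl
  have h2 : W.body.length ≤ W.size + 1 := by simp only [size]; omega
  have h3 : W.n + 2 * (1 + W.body.length) + 3 ≤ 5 * (W.size + 1) := by simp only [size]; omega
  calc _ ≤ _ := h1.trans (Nat.mul_le_mul h2 h3)
    _ = _ := by ring

theorem SelCircuit.length_outs_le (W : SelCircuit) :
    (encodeOuts (List.ofFn W.outs)).length ≤ 3 * (W.size + 1) ^ 2 := by
  have h1 := length_encodeOuts_le (b := W.body.length + 1) (L := List.ofFn W.outs) (by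
    intro p hp
    obtain ⟨o, rfl⟩ := List.mem_ofFn.1 hp
    exact W.outs_lt o)
  simp only [List.length_ofFn] at h1
  have h2 : W.m ≤ W.size + 1 := by simp only [size]; omega
  have h3 : W.body.length + 1 + 2 ≤ 3 * (W.size + 1) := by simp only [size]; omega
  calc _ ≤ _ := h1.trans (Nat.mul_le_mul h2 h3)
    _ = _ := by ring

/-! ### The program for doubling -/

namespace Prog

/-- Write a copy of the circuit on `nd`, `os`, with the selector read from position `q`. -/
def copyPass (q : ℕ) : Prog :=
  clear .dp ;; addCounter .cc .dp ;; pushList .nr (encodeNode (.or q q : Node 0)) ;;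
    push .cc .tick ;; copyNodes .nd ;; moveAll .bk .nd ;; copyOuts .os ;; moveAll .bk .os

def double (x : Bool) : Prog :=
  push .dv .tick ;; pushList .nr ((SelCircuit.xorHeader 0).flatMap encodeNode) ;;
    pushList .cc (ticks 6) ;; copyPass (SelCircuit.selA x) ;; addCounter .nn .dv ;;
    copyPass (SelCircuit.selB x) ;; clear .nd ;; clear .os ;; moveAll .nr .nd ;;
    moveAll .orr .os ;; clear .cc ;; clear .dp ;; moveAll .dv .nn

end Prog

namespace Runs

/-- The counter `cc` holds the position `d` of the next node to be written. The copy gate lands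
there and plays the role of the selector of the copy, which explains the shift by `d`. The backup
restores `nd` and `os` for a further pass. -/
theorem copyPass {n n' v d : ℕ} (hv : n + v ≤ n') (q : ℕ) (L : List (Node n)) (O : List ℕ) {s : Mem}
    (hnd : s.nd = L.flatMap encodeNode) (hos : s.os = encodeOuts O) (hdv : s.dv = ticks v)
    (hcc : s.cc = ticks d) (ht : s.tm = []) (hbk : s.bk = []) :
    Runs (.copyPass q) s
      { s with
        nr := ((Node.or q q :: L.map (Node.shift v d hv)).flatMap encodeNode).reverse ++ s.nr
        orr := (encodeOuts (O.map (· + d))).reverse ++ s.orr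
        dp := ticks d
        cc := ticks (d + 1 + L.length) }
      (2 * s.dp.length + 7 * d + 2 * q + 7 * (L.flatMap encodeNode).length +
        L.length * (14 * (v + d) + 21) + 7 * (encodeOuts O).length + O.length * (7 * d + 10) +
        20) := by
  refine ((clear .dp s).seq ((addCounter (n := d) ?_ ?_ ?_ ?_ ?_).seq
    ((pushList .nr _ _).seq ((push .cc .tick _).seq
    ((copyNodes (v := v) (d := d) (n' := n') (x := []) ?_ hv L ?_ ?_ ?_ ?_ ?_).seq
    ((moveAll ?_ _).seq ((copyOuts (d := d) (x := []) ?_ O ?_ ?_ ?_ ?_).seq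
    (moveAll ?_ _)))))))).of_eq ?_ ?_
  any_goals decide
  any_goals simp [hnd, hos, hdv, hcc, ht, hbk, opensNode, isTop]; done
  · simp [hnd, hos, hcc, hbk, encodeNode, Nat.add_assoc, ← List.replicate_succ]
    omega
  · simp [hnd, hos, hcc, hbk, encodeNode, encodeUnary]
    omega

end Runs

/-- The memory that holds a circuit with a selector and a counter. -/
def SelCircuit.mem (W : SelCircuit) (k : ℕ) : Mem :=
  { nn := ticks W.n
    kk := ticks k
    nd := W.body.flatMap encodeNode
    os := encodeOuts (List.ofFn W.outs) }

theorem encodeOuts_append (L L' : List ℕ) :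
    encodeOuts (L ++ L') = encodeOuts L ++ encodeOuts L' := by
  simp [encodeOuts]

/-- Encoded gates do not record the number of inputs, so a fixed program can write the header as it
stands for `W.n = 0`. -/
theorem SelCircuit.flatMap_double_body (x : Bool) (W : SelCircuit) :
    (W.double x).body.flatMap encodeNode = (xorHeader 0).flatMap encodeNode ++
      (Node.or (selA x) (selA x) :: W.body.map
        (Node.shift (n' := W.n + W.n + 1) 1 6 (by omega))).flatMap encodeNode ++
      (Node.or (selB x) (selB x) :: W.body.map (Node.shift (n' := W.n + W.n + 1) (W.n + 1)
        (W.body.length + 7) (by omega))).flatMap encodeNode := by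
  simp only [double, List.flatMap_append]
  rfl

/-- The first pass leaves `cc` at `W.body.length + 7`, exactly the shift of the second copy, and
adding `nn` to `dv` makes the variable shift `W.n + 1`. -/
theorem Runs.double (x : Bool) (W : SelCircuit) (k : ℕ) :
    Runs (.double x) (W.mem k) ((W.double x).mem k) (5000 * (W.size + 1) ^ 2) := by
  have hl : (List.ofFn W.outs).length = W.m := List.length_ofFn
  refine ((push .dv .tick _).seq ((pushList .nr _ _).seq ((pushList .cc _ _).seq
    ((copyPass (n' := W.n + W.n + 1) (v := 1) (d := 6) (by omega) (SelCircuit.selA x) W.body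
      (List.ofFn W.outs) ?_ ?_ ?_ ?_ ?_ ?_).seq
    ((addCounter (n := W.n) ?_ ?_ ?_ ?_ ?_).seq
    ((copyPass (n' := W.n + W.n + 1) (v := W.n + 1) (d := W.body.length + 7) (by omega)
      (SelCircuit.selB x) W.body (List.ofFn W.outs) ?_ ?_ ?_ ?_ ?_ ?_).seq
    ((clear .nd _).seq ((clear .os _).seq ((moveAll ?_ _).seq ((moveAll ?_ _).seq
    ((clear .cc _).seq ((clear .dp _).seq (moveAll ?_ _))))))))))))).of_eq ?_ ?_
  any_goals decide
  any_goals simp [SelCircuit.mem, ← List.replicate_succ']; done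
  · simp [SelCircuit.mem]
    rfl
  · simp [SelCircuit.mem]
    omega
  · simp [SelCircuit.mem, SelCircuit.flatMap_double_body, SelCircuit.ofFn_double_outs,
      encodeOuts_append]
    rfl
  · have hE := W.length_body_le
    have hO := W.length_outs_le
    -- The lists moved back from `nr` and `orr` at the end are those of the doubled circuit, so its
    -- size bounds the cost of moving them.
    have hE' := (W.double x).length_body_le
    have hO' := (W.double x).length_outs_le
    rw [SelCircuit.flatMap_double_body] at hE'
    rw [SelCircuit.ofFn_double_outs, encodeOuts_append] at hO'
    have hz : ((W.double x).size + 1) ^ 2 ≤ 81 * (W.size + 1) ^ 2 := by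
      have := W.size_double x
      calc ((W.double x).size + 1) ^ 2 ≤ (9 * (W.size + 1)) ^ 2 :=
            Nat.pow_le_pow_left (by omega) 2
        _ = _ := by ring
    have h1 : W.body.length * (14 * (W.n + 1 + (W.body.length + 7)) + 21) ≤
        147 * (W.size + 1) ^ 2 := by
      calc _ ≤ (W.size + 1) * (147 * (W.size + 1)) :=
            Nat.mul_le_mul (by simp only [SelCircuit.size]; omega)
              (by simp only [SelCircuit.size]; omega)
        _ = _ := by ring
    have h2 : W.m * (7 * (W.body.length + 7) + 10) ≤ 66 * (W.size + 1) ^ 2 := by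
      calc _ ≤ (W.size + 1) * (66 * (W.size + 1)) :=
            Nat.mul_le_mul (by simp only [SelCircuit.size]; omega)
              (by simp only [SelCircuit.size]; omega)
        _ = _ := by ring
    have h3 : W.n + W.m + W.body.length + 1 ≤ (W.size + 1) ^ 2 :=
      Nat.le_self_pow (by norm_num) (W.size + 1)
    have h4 : SelCircuit.selA x ≤ 1 := by cases x <;> simp [SelCircuit.selA]
    have h5 : SelCircuit.selB x ≤ 5 := by cases x <;> simp [SelCircuit.selB]
    simp [SelCircuit.mem] at hE hO hE' hO' ⊢
    omega

/-! ### From a pair of circuits to a circuit with a selector -/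

/-- Multiplexers for the listed positions, the first at position `c`, controlled by the selector at
position `0` and its negation at position `1`. -/
def muxNodes {n : ℕ} : ℕ → List ℕ → List ℕ → List (Node n)
  | c, p :: A, q :: B => .and 1 p :: .and 0 q :: .or c (c + 1) :: muxNodes (c + 3) A B
  | _, _, _ => []

/-- The output positions of multiplexers. -/
def muxOuts (c m : ℕ) : List ℕ := List.ofFn fun o : Fin m => c + 3 * o + 2

theorem muxOuts_succ (c m : ℕ) : muxOuts c (m + 1) = (c + 2) :: muxOuts (c + 3) m := by
  simp only [muxOuts, List.ofFn_succ]
  congr 1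
  congr 1
  funext o
  simp
  omega

theorem length_muxNodes {n : ℕ} {c : ℕ} {A B : List ℕ} (h : A.length = B.length) :
    (muxNodes c A B : List (Node n)).length = 3 * A.length := by
  induction A generalizing c B with
  | nil => simp [muxNodes]
  | cons p A ih =>
    obtain _ | ⟨q, B⟩ := B
    · simp at h
    · simp [muxNodes, ih (by simpa using h)]
      omega

theorem predsLt_muxNodes {n : ℕ} {c : ℕ} {A B : List ℕ} (hc : 1 < c) (hA : ∀ p ∈ A, p < c)
    (hB : ∀ p ∈ B, p < c) : PredsLt c (muxNodes c A B : List (Node n)) := by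
  induction A generalizing c B with
  | nil => simp [muxNodes, PredsLt]
  | cons p A ih =>
    obtain _ | ⟨q, B⟩ := B
    · simp [muxNodes, PredsLt]
    · simp only [List.mem_cons, forall_eq_or_imp] at hA hB
      refine ⟨?_, ?_, ?_, ih (by omega) (fun r hr => ?_) (fun r hr => ?_)⟩
      · simp [Node.preds]; omega
      · simp [Node.preds]; omega
      · simp [Node.preds]
      · have := hA.2 r hr; omega
      · have := hB.2 r hr; omega

theorem Circuit.predsLt {n m : ℕ} (C : Circuit n m) : PredsLt 0 C.nodes :=
  PredsLt.iff_getElem.2 (by simpa using C.preds_lt)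

namespace CircuitPair

/-- The positions of the outputs of the first circuit inside the joint circuit. -/
def outsX (P : CircuitPair) : List ℕ := (List.ofFn P.X.outputs).map (· + 2)

/-- The positions of the outputs of the second circuit inside the joint circuit. -/
def outsY (P : CircuitPair) : List ℕ :=
  (List.ofFn P.Y.outputs).map (· + (2 + P.X.nodes.length))

/-- The circuit that computes the first or the second circuit, as the selector says. -/
def sel (P : CircuitPair) : SelCircuit where
  n := P.n
  m := P.m
  -- Position 1 holds the negated selector, the first circuit starts at 2, the second follows it,
  -- and each output gets a triple of gates whose third (offset 2) is the multiplexed bit.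
  body := .not 0 :: (P.X.nodes.map (Node.shift 0 2 le_rfl) ++
    (P.Y.nodes.map (Node.shift 0 (2 + P.X.nodes.length) le_rfl) ++
    muxNodes (2 + P.X.nodes.length + P.Y.nodes.length) P.outsX P.outsY))
  outs := fun o => 2 + P.X.nodes.length + P.Y.nodes.length + 3 * o + 2
  predsLt := by
    refine ⟨by simp [Node.preds], ?_⟩
    simp only [PredsLt.append, List.length_map]
    refine ⟨?_, ?_, ?_⟩
    · simpa using PredsLt.shift (d := 2) le_rfl P.X.predsLt
    · simpa using PredsLt.shift (d := 2 + P.X.nodes.length) le_rfl P.Y.predsLt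
    · refine predsLt_muxNodes (by omega) (fun p hp => ?_) (fun p hp => ?_)
      · simp only [outsX, List.mem_map, List.mem_ofFn] at hp
        obtain ⟨_, ⟨o, rfl⟩, rfl⟩ := hp
        have := P.X.outputs_lt o
        omega
      · simp only [outsY, List.mem_map, List.mem_ofFn] at hp
        obtain ⟨_, ⟨o, rfl⟩, rfl⟩ := hp
        have := P.Y.outputs_lt o
        omega
  outs_lt := by
    intro o
    simp only [List.length_cons, List.length_append, List.length_map]
    rw [length_muxNodes (by simp [outsX, outsY])]
    simp [outsX]
    omega

end CircuitPair

theorem length_le_flatMap_encodeNode {n : ℕ} (L : List (Node n)) :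
    L.length ≤ (L.flatMap encodeNode).length := by
  induction L with
  | nil => simp
  | cons g L ih =>
    have : 1 ≤ (encodeNode g).length := by
      rcases g with i | (_ | _) | p | ⟨p, q⟩ | ⟨p, q⟩ <;> simp [encodeNode]
    simp only [List.flatMap_cons, List.length_append, List.length_cons]
    omega

theorem length_le_encodeOuts (L : List ℕ) : L.length ≤ (encodeOuts L).length := by
  induction L with
  | nil => simp
  | cons p L ih =>
    simp only [encodeOuts, List.flatMap_cons, List.length_append, List.length_cons] at ih ⊢
    omega

theorem encodeCircuit_eq {n m : ℕ} (C : Circuit n m) : encodeCircuit C =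
    C.nodes.flatMap encodeNode ++ encodeOuts (List.ofFn C.outputs) ++ [Letter.fin] := rfl

theorem CircuitPair.length_encodePair (P : CircuitPair) : (encodePair P).length =
    P.n + (P.X.nodes.flatMap encodeNode).length + (encodeOuts (List.ofFn P.X.outputs)).length +
    (P.Y.nodes.flatMap encodeNode).length + (encodeOuts (List.ofFn P.Y.outputs)).length + 3 := by
  simp only [encodePair, encodeCircuit_eq, encodeUnary, List.length_append, List.length_replicate,
    List.length_cons, List.length_nil]
  omega

theorem CircuitPair.size_sel (P : CircuitPair) : P.sel.size ≤ 4 * (encodePair P).length := by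
  have h1 := length_le_flatMap_encodeNode P.X.nodes
  have h2 := length_le_flatMap_encodeNode P.Y.nodes
  have h3 := length_le_encodeOuts (List.ofFn P.X.outputs)
  have h4 : (muxNodes (2 + P.X.nodes.length + P.Y.nodes.length) P.outsX P.outsY :
    List (Node P.n)).length = 3 * P.m := by
    rw [length_muxNodes (by simp [outsX, outsY])]
    simp [outsX]
  rw [P.length_encodePair]
  simp only [List.length_ofFn] at h3
  simp only [SelCircuit.size, sel, List.length_cons, List.length_append, List.length_map, h4]
  omega

theorem ticks_append_cons (c : ℕ) (l : List Letter) :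
    ticks c ++ .tick :: l = .tick :: (ticks c ++ l) := by
  induction c with
  | zero => rfl
  | succ c ih => simpa [List.replicate_succ] using ih

theorem length_encodeOuts_map_add (d : ℕ) (L : List ℕ) :
    (encodeOuts (L.map (· + d))).length = (encodeOuts L).length + L.length * d := by
  induction L with
  | nil => simp [encodeOuts]
  | cons p L ih =>
    simp only [encodeOuts, List.flatMap_cons, List.length_append, List.length_cons, encodeUnary,
      Nat.add_mul, List.length_replicate, List.length_nil, List.map_cons] at ih ⊢
    omega

/-! ### The program for the selector circuit -/

namespace Prog

/-- Read a circuit from the input and write its nodes to `nr`, its outputs to `t`. -/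
def readCircuit (t : Stk) : Prog :=
  clear .dp ;; addCounter .cc .dp ;; copyNodes .inp ;; clear .bk ;; copyOuts .inp ;; clear .bk ;;
    pop .inp ;; moveAll .orr t

/-- Read an output from `t` and write its position to `nr`. -/
def readOut (t : Stk) : Prog :=
  pop t ;; loop t (isTop .tick) (move t .nr) ;; move t .nr

/-- Write multiplexers for the outputs on `t1` and `t2`. -/
def mux : Prog :=
  loop .t1 (isTop .out) (clear .dp ;; addCounter .cc .dp ;;
    pushList .nr [.and, .tick, .comma] ;; readOut .t1 ;;
    pushList .nr [.and, .comma] ;; readOut .t2 ;;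
    push .nr .or ;; addCounter .dp .nr ;; push .nr .comma ;; addCounter .dp .nr ;;
    pushList .nr [.tick, .comma] ;; push .orr .out ;; addCounter .dp .orr ;;
    pushList .orr [.tick, .tick, .comma] ;; pushList .cc (ticks 3))

/-- Read a number from the input to `j`. -/
def readNum (j : Stk) : Prog := loop .inp (isTop .tick) (move .inp j) ;; pop .inp

/-- Read a pair of circuits from the input and write the circuit with a selector. -/
def readPair : Prog :=
  readNum .nn ;; pushList .nr (encodeNode (.not 0 : Node 0)) ;; pushList .cc (ticks 2) ;;
    readCircuit .t1 ;; readCircuit .t2 ;; mux ;; moveAll .nr .nd ;; moveAll .orr .os ;;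
    clear .cc ;; clear .dp

end Prog

/-! ### Reading a pair of circuits -/

namespace Runs

theorem of_eq_left {p : Prog} {s s' s'' : Mem} {t : ℕ} (h : Runs p s s' t) (hs : s'' = s) :
    Runs p s'' s' t := hs ▸ h

theorem readNum {j : Stk} (hj : Stk.inp ≠ j) {p : ℕ} {x : List Letter} {s : Mem}
    (h : s.inp = encodeUnary p ++ x) :
    Runs (.readNum j) s ((s.set .inp x).set j (ticks p ++ s.get j)) (3 * p + 2) := by
  refine ((moveTicks (p := p) (a := .comma) (x := x) hj ?_ (by decide)).seq
    (pop (a := .comma) (x := x) ?_)).of_eq ?_ (by omega)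
  · simpa [encodeUnary] using h
  · rw [Mem.get_set_self]
  · rw [Mem.set_set, Mem.set_comm _ hj]

theorem readOut {t : Stk} (ht : t ≠ .nr) {p : ℕ} {x : List Letter} {s : Mem}
    (h : s.get t = .out :: (encodeUnary p ++ x)) :
    Runs (.readOut t) s ((s.set .nr ((encodeUnary p).reverse ++ s.nr)).set t x) (3 * p + 4) := by
  refine ((pop h).seq ((moveTicks (p := p) (a := .comma) (x := x) ht ?_ (by decide)).seq
    (move (a := .comma) (x := x) ht ?_))).of_eq ?_ (by omega)
  · simp [Mem.get_set_self, encodeUnary]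
  · rw [Mem.get_set_self]
  · have e : s.nr = s.get .nr := rfl
    rw [e]
    apply Mem.get_injective
    funext k
    simp only [Mem.get_set, Function.update_apply]
    cases k <;> simp [ht.symm, encodeUnary] <;> grind

theorem readCircuit {t : Stk} (ht : t = .t1 ∨ t = .t2) {n m d : ℕ} (C : Circuit n m)
    {x : List Letter} {s : Mem} (hi : s.inp = encodeCircuit C ++ x) (ho : s.orr = [])
    (hdv : s.dv = []) (hcc : s.cc = ticks d) (hm : s.tm = []) (hbk : s.bk = [])
    (hs : s.get t = []) :
    Runs (.readCircuit t) s
      (Mem.set { s with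
        inp := x
        nr := ((C.nodes.map (Node.shift 0 d le_rfl)).flatMap encodeNode).reverse ++ s.nr
        dp := ticks d
        cc := ticks (d + C.nodes.length) } t
        (encodeOuts ((List.ofFn C.outputs).map (· + d))))
      (2 * s.dp.length + 7 * d + 6 * (C.nodes.flatMap encodeNode).length +
        C.nodes.length * (14 * d + 21) + 6 * (encodeOuts (List.ofFn C.outputs)).length +
        m * (7 * d + 10) + 3 * (encodeOuts ((List.ofFn C.outputs).map (· + d))).length + 20) := by
  refine ((clear .dp s).seq ((addCounter (n := d) ?_ ?_ ?_ ?_ ?_).seq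
    ((copyNodes (v := 0) (d := d) (n' := n)
      (x := encodeOuts (List.ofFn C.outputs) ++ .fin :: x) ?_ le_rfl C.nodes ?_ ?_ ?_ ?_ ?_).seq
    ((clear .bk _).seq ((copyOuts (d := d) (x := .fin :: x) ?_ (List.ofFn C.outputs) ?_ ?_ ?_ ?_).seq
    ((clear .bk _).seq ((pop (a := .fin) (x := x) ?_).seq (moveAll ?_ _)))))))).of_eq ?_ ?_
  any_goals decide
  any_goals simp [hi, ho, hdv, hcc, hm, hbk, isTop, encodeCircuit_eq]; done
  · cases List.ofFn C.outputs <;> rfl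
  · rcases ht with rfl | rfl <;> decide
  · rcases ht with rfl | rfl
    · replace hs : s.t1 = [] := hs
      simp [ho, hcc, hbk, hs, Nat.add_comm]
    · replace hs : s.t2 = [] := hs
      simp [ho, hcc, hbk, hs, Nat.add_comm]
  · simp [ho, hbk]
    omega

/-- The stack `dp` ends with whatever the last pass left there and is cleared afterwards, so only
its length matters. The uniform bound `M` on all positions keeps the cost per output fixed during
the induction. -/
theorem mux {n : ℕ} (M : ℕ) (A B : List ℕ) (hAB : A.length = B.length) (hA : ∀ p ∈ A, p ≤ M)
    (hB : ∀ p ∈ B, p ≤ M) {c : ℕ} {s : Mem} (hc : c + 3 * A.length ≤ M) (hd : s.dp.length ≤ M)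
    (h1 : s.t1 = encodeOuts A) (h2 : s.t2 = encodeOuts B) (hcc : s.cc = ticks c)
    (hm : s.tm = []) :
    ∃ D : List Letter, D.length ≤ M ∧ Runs .mux s
      { s with
        nr := ((muxNodes c A B : List (Node n)).flatMap encodeNode).reverse ++ s.nr
        orr := (encodeOuts (muxOuts c A.length)).reverse ++ s.orr
        t1 := []
        t2 := []
        dp := D
        cc := ticks (c + 3 * A.length) }
      (A.length * (40 * M + 60) + 1) := by
  induction A generalizing B c s with
  | nil =>
    obtain _ | ⟨q, B⟩ := B
    · refine ⟨s.dp, hd, (loop_done ?_).of_eq ?_ (by simp)⟩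
      · simp [h1, encodeOuts, isTop]
      · have h1' : s.t1 = [] := h1
        have h2' : s.t2 = [] := h2
        apply Mem.ext <;> simp [muxNodes, muxOuts, encodeOuts, h1', h2', hcc]
    · simp at hAB
  | cons p A ih =>
    obtain _ | ⟨q, B⟩ := B
    · simp at hAB
    · simp only [List.mem_cons, forall_eq_or_imp, List.length_cons] at hA hB hc hAB
      replace h1 : s.t1 = .out :: (encodeUnary p ++ encodeOuts A) := h1
      replace h2 : s.t2 = .out :: (encodeUnary q ++ encodeOuts B) := h2
      obtain ⟨D, hD, hR⟩ := ih (c := c + 3) (s := { s with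
        nr := (([.and 1 p, .and 0 q, .or c (c + 1)] : List (Node n)).flatMap encodeNode).reverse ++
          s.nr
        orr := (.out :: encodeUnary (c + 2)).reverse ++ s.orr
        t1 := encodeOuts A
        t2 := encodeOuts B
        dp := ticks c
        cc := ticks (c + 3) }) B (by omega) hA.2 hB.2 (by omega) (by simp; omega) rfl rfl rfl hm
      refine ⟨D, hD, (loop_step (by simp [h1, isTop]) (((clear .dp s).seq
        ((addCounter (n := c) ?_ ?_ ?_ ?_ ?_).seq ((pushList .nr _ _).seq
        ((readOut (p := p) (x := encodeOuts A) ?_ ?_).seq ((pushList .nr _ _).seq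
        ((readOut (p := q) (x := encodeOuts B) ?_ ?_).seq ((push .nr .or _).seq
        ((addCounter (n := c) ?_ ?_ ?_ ?_ ?_).seq ((push .nr .comma _).seq
        ((addCounter (n := c) ?_ ?_ ?_ ?_ ?_).seq ((pushList .nr _ _).seq
        ((push .orr .out _).seq ((addCounter (n := c) ?_ ?_ ?_ ?_ ?_).seq
        ((pushList .orr _ _).seq (pushList .cc _ _))))))))))))))).of_eq
          (u := 36 * M + 50) ?_ ?_) hR).of_eq ?_ ?_⟩
      any_goals decide
      any_goals simp [h1, h2, hcc, hm]; done
      · simp [hcc, encodeNode, encodeUnary, List.replicate_succ, ticks_append_cons]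
      · have := hA.1
        have := hB.1
        simp
        omega
      · simp [muxNodes, muxOuts_succ, encodeOuts]
        omega
      · simp [Nat.add_mul]
        omega

/-- The unread rest `x` is empty for a fixed `k` and holds the encoding of `1^k` in the uniform
version. -/
theorem readPair (P : CircuitPair) (x : List Letter) :
    Runs .readPair { inp := encodePair P ++ x } { P.sel.mem 0 with inp := x }
      (2000 * ((encodePair P).length + 1) ^ 2) := by
  have hX : ∀ p ∈ P.outsX, p ≤ 2 + P.X.nodes.length + P.Y.nodes.length + 3 * P.m := by
    simp only [CircuitPair.outsX, List.mem_map, List.mem_ofFn]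
    rintro _ ⟨_, ⟨o, rfl⟩, rfl⟩
    have := P.X.outputs_lt o
    omega
  have hY : ∀ p ∈ P.outsY, p ≤ 2 + P.X.nodes.length + P.Y.nodes.length + 3 * P.m := by
    simp only [CircuitPair.outsY, List.mem_map, List.mem_ofFn]
    rintro _ ⟨_, ⟨o, rfl⟩, rfl⟩
    have := P.Y.outputs_lt o
    omega
  have lX : P.outsX.length = P.m := by simp [CircuitPair.outsX]
  have lY : P.outsY.length = P.m := by simp [CircuitPair.outsY]
  -- The witness `D` has to be available before the run is assembled, so `mux` is applied in advance
  -- to the memory that is reached once both circuits have been read.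
  obtain ⟨D, hD, hmux⟩ := mux (n := P.n) _ _ _ (lX.trans lY.symm) hX hY
    (c := 2 + P.X.nodes.length + P.Y.nodes.length) (s :=
      { inp := x
        nn := ticks P.n
        nr := ((P.Y.nodes.map (Node.shift 0 (2 + P.X.nodes.length) le_rfl)).flatMap
          encodeNode).reverse ++ (((P.X.nodes.map (Node.shift 0 2 le_rfl)).flatMap
          encodeNode).reverse ++ (encodeNode (.not 0 : Node 0)).reverse)
        t1 := encodeOuts P.outsX
        t2 := encodeOuts P.outsY
        dp := ticks (2 + P.X.nodes.length)
        cc := ticks (2 + P.X.nodes.length + P.Y.nodes.length) })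
    (by omega) (by simp; omega) rfl rfl rfl rfl
  refine ((readNum (j := .nn) (p := P.n) (x := encodeCircuit P.X ++ (encodeCircuit P.Y ++ x))
    ?_ ?_).seq ((pushList .nr _ _).seq ((pushList .cc _ _).seq
    ((readCircuit (t := .t1) (d := 2) (x := encodeCircuit P.Y ++ x) ?_ P.X ?_ ?_ ?_ ?_ ?_ ?_ ?_).seq
    ((readCircuit (t := .t2) (d := 2 + P.X.nodes.length) (x := x) ?_ P.Y ?_ ?_ ?_ ?_ ?_ ?_ ?_).seq
    ((hmux.of_eq_left ?_).seq ((moveAll ?_ _).seq ((moveAll ?_ _).seq ((clear .cc _).seq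
    (clear .dp _)))))))))).of_eq ?_ ?_
  any_goals decide
  any_goals simp [encodePair]; done
  · rfl
  · simp [CircuitPair.outsX, CircuitPair.outsY]
  · apply Mem.ext
    any_goals rfl
    all_goals simp [SelCircuit.mem, CircuitPair.sel, lX, muxOuts]
    rfl
  · have hz : (P.sel.size + 1) ^ 2 ≤ 16 * ((encodePair P).length + 1) ^ 2 := by
      have := P.size_sel
      calc (P.sel.size + 1) ^ 2 ≤ (4 * ((encodePair P).length + 1)) ^ 2 :=
            Nat.pow_le_pow_left (by omega) 2
        _ = _ := by ring
    have hE := P.sel.length_body_le.trans (Nat.mul_le_mul_left 5 hz)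
    have hO := P.sel.length_outs_le.trans (Nat.mul_le_mul_left 3 hz)
    have g1 := length_le_flatMap_encodeNode P.X.nodes
    have g2 := length_le_flatMap_encodeNode P.Y.nodes
    have g3 := length_le_encodeOuts (List.ofFn P.X.outputs)
    have g4 := P.length_encodePair
    have e : encodeOuts (List.ofFn P.sel.outs) =
      encodeOuts (muxOuts (2 + P.X.nodes.length + P.Y.nodes.length) P.m) := rfl
    have e' : encodeNode (.not 0 : Node P.n) = encodeNode (.not 0 : Node 0) := rfl
    rw [e] at hO
    simp only [List.length_ofFn] at g3
    have hl : P.X.nodes.length + P.Y.nodes.length + P.m + 3 ≤ (encodePair P).length := by omega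
    have prod : ∀ {u v c : ℕ}, u ≤ (encodePair P).length + 1 → v ≤ c * ((encodePair P).length + 1) →
        u * v ≤ c * ((encodePair P).length + 1) ^ 2 := fun {u v c} hu hv =>
      (Nat.mul_le_mul hu hv).trans (le_of_eq (by ring))
    have p1 : P.Y.nodes.length * (14 * (2 + P.X.nodes.length) + 21) ≤
        49 * ((encodePair P).length + 1) ^ 2 := prod (by omega) (by omega)
    have p2 : P.m * (7 * (2 + P.X.nodes.length) + 10) ≤
        24 * ((encodePair P).length + 1) ^ 2 := prod (by omega) (by omega)
    have p3 : P.m * (2 + P.X.nodes.length) ≤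
        2 * ((encodePair P).length + 1) ^ 2 := prod (by omega) (by omega)
    have p4 : P.m * (40 * (2 + P.X.nodes.length + P.Y.nodes.length + 3 * P.m) + 60) ≤
        180 * ((encodePair P).length + 1) ^ 2 := prod (by omega) (by omega)
    have p5 : (encodePair P).length + 1 ≤ ((encodePair P).length + 1) ^ 2 :=
      Nat.le_self_pow (by norm_num) _
    have p6 : (encodeNode (.not 0 : Node 0)).length = 2 := rfl
    clear hmux hX hY
    simp only [length_encodeOuts_map_add]
    simp [CircuitPair.sel, e', lX] at hE hO g1 g2 g4 ⊢
    omega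

end Runs

/-! ### The program for amplification -/

namespace Prog

/-- Halve the counter `kk`. -/
def halve : Prog :=
  loop .kk (isTop .tick) (pop .kk ;; ite .kk (isTop .tick) (move .kk .t1) skip) ;; moveAll .t1 .kk

/-- Copy the contents of `k` on top of the output. -/
def emitCopy (k : Stk) : Prog := moveAll k .t1 ;; loop .t1 Option.isSome (fork .t1 .out k)

/-- Write the circuits with selector `ff` and `tt` to the output. -/
def emitPair : Prog :=
  push .out .fin ;; emitCopy .os ;; emitCopy .nd ;; push .out .tt ;; push .out .fin ;;
    emitCopy .os ;; emitCopy .nd ;; push .out .ff ;; push .out .comma ;; moveAll .nn .out ;;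
    clear .nd ;; clear .os

def rep (p : Prog) : ℕ → Prog
  | 0 => skip
  | n + 1 => p ;; rep p n

def amplifyLoop : Prog := loop .kk (isTop .tick) (double true ;; double false ;; halve)

/-- Amplify the circuit with a selector. -/
def amplify (h j : ℕ) : Prog :=
  rep (double true) h ;; rep (double false) j ;; amplifyLoop ;; emitPair

/-- Read a number to `kk`, and amplify a given pair as often as its length says. -/
def amplifyPairParam (h j : ℕ) : Prog := readPair ;; readNum .kk ;; amplify h j

/-- Amplify a given pair as often as the length of `k` says. -/
def amplifyPair (h j k : ℕ) : Prog := readPair ;; pushList .kk (ticks k) ;; amplify h j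

/-- Replace the input by a constant. -/
def constant (l : List Letter) : Prog := clear .inp ;; pushList .out l.reverse

end Prog

namespace SelCircuit

/-- One round of amplification. -/
def round (W : SelCircuit) : SelCircuit := (W.double true).double false

/-- Reduce the statistical difference, then increase the disjointness, then amplify both. -/
def amplified (h j k : ℕ) (W : SelCircuit) : SelCircuit :=
  round^[Nat.size k] ((double false)^[j] ((double true)^[h] W))

end SelCircuit

theorem Nat.size_eq_size_half_add_one {k : ℕ} (hk : k ≠ 0) : k.size = (k / 2).size + 1 := by
  conv_lhs => rw [← Nat.bit_bodd_div2 k]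
  rw [Nat.size_bit (by rwa [Nat.bit_bodd_div2]), Nat.div2_val]

/-- This keeps the output polynomial: `k.size` rounds multiply the size by about `4 ^ k.size`, which
is at most `(2 * k + 1) ^ 2`. -/
theorem Nat.two_pow_size_le (k : ℕ) : 2 ^ k.size ≤ 2 * k + 1 := by
  induction k using Nat.strong_induction_on with
  | _ k ih =>
    rcases eq_or_ne k 0 with rfl | hk
    · simp
    · rw [Nat.size_eq_size_half_add_one hk, pow_succ]
      rcases eq_or_ne (k / 2) 0 with h | h
      · rw [h]; simp; omega
      · have := ih (k / 2) (by omega)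
        -- The induction hypothesis alone is off by one; an even number at most `2 * (k / 2) + 1` is
        -- at most `2 * (k / 2)`, hence at most `k`.
        have h2 : (2 : ℕ) ∣ 2 ^ (k / 2).size :=
          dvd_pow_self 2 (by rw [Nat.size_eq_size_half_add_one h]; omega)
        omega

/-! ### Effect and running time of the amplification -/

namespace Runs

theorem halve_loop (k : ℕ) {s : Mem} (h : s.kk = ticks k) :
    Runs (.loop .kk (isTop .tick) (.pop .kk ;; .ite .kk (isTop .tick) (.move .kk .t1) .skip)) s
      { s with kk := [], t1 := ticks (k / 2) ++ s.t1 } (5 * k + 1) := by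
  induction k using Nat.strong_induction_on generalizing s with
  | _ k ih =>
    obtain _ | _ | k := k
    · refine (loop_done (by simp [h, isTop])).of_eq ?_ (by omega)
      apply Mem.ext <;> simp [h]
    · refine (loop_step (by simp [h, isTop]) ((pop (a := .tick) (x := []) (by simp [h])).seq
        (ite_false (by simp [isTop]) (skip _))) (loop_done (by simp [isTop]))).of_eq ?_ (by omega)
      simp
    · refine (loop_step (by simp [h, isTop, List.replicate_succ])
        ((pop (a := .tick) (x := ticks (k + 1)) (by simp [h, List.replicate_succ])).seq
        (ite_true (by simp [isTop, List.replicate_succ])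
          (move (a := .tick) (x := ticks k) (by decide) (by simp [List.replicate_succ]))))
        (ih k (by omega) (by simp))).of_eq ?_ (by omega)
      have : (k + 1 + 1) / 2 = k / 2 + 1 := by omega
      simp [this, List.replicate_succ, ticks_append_cons]

theorem halve (W : SelCircuit) (k : ℕ) :
    Runs .halve (W.mem k) (W.mem (k / 2)) (7 * k + 2) := by
  refine ((halve_loop k rfl).seq (moveAll (by decide) _)).of_eq ?_ (by simp [SelCircuit.mem]; omega)
  simp [SelCircuit.mem]

/-- Passing through `t1` reverses the list twice, so both the output and the restored stack `k` have
the original order. -/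
theorem emitCopy {k : Stk} (hk : k ≠ .t1) (hk' : k ≠ .out) {s : Mem} (ht : s.t1 = []) :
    Runs (.emitCopy k) s (s.set .out (s.get k ++ s.out)) (7 * (s.get k).length + 2) := by
  replace ht : s.get .t1 = [] := ht
  refine ((moveAll hk s).seq (loop_fork (l := (s.get k).reverse) (x := []) (by decide) hk.symm
    hk'.symm ?_ (by simp) (by simp))).of_eq ?_ (by simp; omega)
  · simp [Mem.get_set_of_ne _ hk.symm, ht]
  · have e : s.out = s.get .out := rfl
    rw [e]
    apply Mem.get_injective
    funext i
    simp only [Mem.get_set, Function.update_apply]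
    grind

/-- The output is a stack, so the word is written from its last letter backwards. The two circuits
differ only in the constant placed at position 0. -/
theorem emitPair (W : SelCircuit) :
    Runs .emitPair (W.mem 0) { out := encodePair W.pair } (200 * (W.size + 1) ^ 2) := by
  have hE := W.length_body_le
  have hO := W.length_outs_le
  have hn : W.n + 1 ≤ (W.size + 1) ^ 2 :=
    le_trans (by simp only [SelCircuit.size]; omega)
      (Nat.le_self_pow (show 2 ≠ 0 by norm_num) (W.size + 1))
  refine ((push .out .fin _).seq ((emitCopy (by decide) (by decide) ?_).seq
    ((emitCopy (by decide) (by decide) ?_).seq ((push .out .tt _).seq ((push .out .fin _).seq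
    ((emitCopy (by decide) (by decide) ?_).seq ((emitCopy (by decide) (by decide) ?_).seq
    ((push .out .ff _).seq ((push .out .comma _).seq ((moveAll (by decide) _).seq
    ((clear .nd _).seq (clear .os _)))))))))))).of_eq ?_ ?_
  any_goals simp [SelCircuit.mem]; done
  · simp [SelCircuit.mem, encodePair, encodeCircuit_eq, SelCircuit.pair, SelCircuit.circuit,
      encodeUnary, encodeNode]
  · simp [SelCircuit.mem] at hE hO ⊢
    omega

/-- `Z` dominates the sizes of all intermediate circuits; its hypothesis passes to the next step
because `size + 8` at most doubles. -/
theorem rep_double (x : Bool) (h : ℕ) (W : SelCircuit) (k : ℕ) {Z : ℕ}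
    (hZ : 2 ^ h * (W.size + 8) ≤ Z) :
    Runs (.rep (.double x) h) (W.mem k) (((SelCircuit.double x)^[h] W).mem k)
      (h * (5000 * Z ^ 2) + 1) := by
  induction h generalizing W with
  | zero => simpa [Prog.rep] using skip _
  | succ h ih =>
    have hs := W.size_double x
    have h1 : 2 ^ h * ((W.double x).size + 8) ≤ Z := by
      refine le_trans ?_ hZ
      rw [pow_succ, Nat.mul_assoc]
      exact Nat.mul_le_mul_left _ (by omega)
    have h2 : W.size + 1 ≤ Z := by
      refine le_trans ?_ hZ
      exact le_trans (by omega) (Nat.le_mul_of_pos_left (W.size + 8) (by positivity))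
    refine ((double x W k).seq (ih _ h1)).of_eq rfl ?_
    have := Nat.pow_le_pow_left h2 2
    rw [Nat.add_mul]
    omega

/-- Halving `kk` until it is empty takes `k.size` passes. The bound `K` stays fixed while `k`
shrinks in the induction, so that every pass has the same cost bound. -/
theorem amplifyLoop (K : ℕ) {k : ℕ} (hk : k ≤ K) (W : SelCircuit) {Z : ℕ}
    (hZ : 4 ^ k.size * (W.size + 8) ≤ Z) :
    Runs .amplifyLoop (W.mem k) ((SelCircuit.round^[k.size] W).mem 0)
      (k.size * (10000 * Z ^ 2 + 7 * K + 3) + 1) := by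
  induction k using Nat.strong_induction_on generalizing W with
  | _ k ih =>
    rcases eq_or_ne k 0 with rfl | h0
    · exact (loop_done (by simp [SelCircuit.mem, isTop])).of_eq (by simp) (by simp)
    · have hs1 := W.size_double true
      have hs2 := (W.double true).size_double false
      have es := Nat.size_eq_size_half_add_one h0
      have h1 : 4 ^ (k / 2).size * (W.round.size + 8) ≤ Z := by
        refine le_trans ?_ hZ
        rw [es, pow_succ, Nat.mul_assoc]
        exact Nat.mul_le_mul_left _ (by simp only [SelCircuit.round]; omega)
      have h2 : 4 * (W.size + 8) ≤ Z := by
        refine le_trans ?_ hZ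
        rw [es, pow_succ, Nat.mul_assoc]
        exact Nat.le_mul_of_pos_left _ (by positivity)
      refine (loop_step ?_ ((double true W k).seq ((double false _ k).seq (halve _ k)))
        (ih (k / 2) (by omega) (by omega) W.round h1)).of_eq ?_ ?_
      · obtain ⟨k, rfl⟩ := Nat.exists_eq_succ_of_ne_zero h0
        simp [SelCircuit.mem, isTop, List.replicate_succ]
      · rw [es, Function.iterate_succ_apply]
      · have g1 : (W.size + 1) ^ 2 ≤ Z ^ 2 := Nat.pow_le_pow_left (by omega) 2
        have g2 : ((W.double true).size + 1) ^ 2 ≤ Z ^ 2 := Nat.pow_le_pow_left (by omega) 2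
        rw [es, Nat.add_mul]
        omega

end Runs

theorem SelCircuit.size_iterate_double (x : Bool) (h : ℕ) (W : SelCircuit) :
    ((double x)^[h] W).size + 8 ≤ 2 ^ h * (W.size + 8) := by
  induction h generalizing W with
  | zero => simp
  | succ h ih =>
    rw [Function.iterate_succ_apply]
    have hs := W.size_double x
    refine (ih _).trans ?_
    rw [pow_succ, Nat.mul_assoc]
    exact Nat.mul_le_mul_left _ (by omega)

theorem SelCircuit.size_iterate_round (h : ℕ) (W : SelCircuit) :
    (round^[h] W).size + 8 ≤ 4 ^ h * (W.size + 8) := by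
  induction h generalizing W with
  | zero => simp
  | succ h ih =>
    rw [Function.iterate_succ_apply]
    have hs1 := W.size_double true
    have hs2 := (W.double true).size_double false
    refine (ih _).trans ?_
    rw [pow_succ, Nat.mul_assoc]
    exact Nat.mul_le_mul_left _ (by simp only [round]; omega)

/-- The coefficient of the running time of the amplification. -/
def ampCost (h j : ℕ) : ℕ := (5000 * (h + j) + 20000) * (2 ^ (h + j) * 32) ^ 2

/-- For N the input length including `k`, the initial size is O(N) and the rounds multiply it by
O(N²), so circuits have size Z = O(N³). Each doubling costs O(Z²), and at most N rounds give the
exponent 7. -/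
theorem Runs.amplify (h j k : ℕ) (P : CircuitPair) :
    Runs (.amplify h j) (P.sel.mem k) { out := encodePair (P.sel.amplified h j k).pair }
      (ampCost h j * ((encodePair P).length + k + 1) ^ 7) := by
  set N := (encodePair P).length + k + 1 with hN
  have hk : 4 ^ k.size ≤ 4 * N ^ 2 := by
    have := Nat.pow_le_pow_left ((Nat.two_pow_size_le k).trans (show 2 * k + 1 ≤ 2 * N by omega)) 2
    calc 4 ^ k.size = (2 ^ k.size) ^ 2 := by
          rw [← pow_mul, Nat.mul_comm, pow_mul]
          norm_num
      _ ≤ _ := this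
      _ = _ := by ring
  have hs : P.sel.size + 8 ≤ 8 * N := by
    have := P.size_sel
    have := P.length_encodePair
    omega
  have hN3 : N ≤ N ^ 3 := Nat.le_self_pow (by norm_num) N
  set W := (SelCircuit.double false)^[j] ((SelCircuit.double true)^[h] P.sel) with hW
  have e1 := SelCircuit.size_iterate_double true h P.sel
  have e2 := SelCircuit.size_iterate_double false j ((SelCircuit.double true)^[h] P.sel)
  have e3 : W.size + 8 ≤ 2 ^ (h + j) * (8 * N) := by
    refine e2.trans ?_
    rw [pow_add, Nat.mul_comm (2 ^ h), Nat.mul_assoc]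
    exact Nat.mul_le_mul_left _ (e1.trans (Nat.mul_le_mul_left _ hs))
  have e4 : 4 ^ k.size * (W.size + 8) ≤ 2 ^ (h + j) * 32 * N ^ 3 :=
    (Nat.mul_le_mul hk e3).trans (le_of_eq (by ring))
  have e5 := (SelCircuit.size_iterate_round k.size W).trans e4
  set Z := 2 ^ (h + j) * 32 * N ^ 3 with hZ
  have hp : ∀ {a b : ℕ}, a ≤ b → 2 ^ a * (8 * N) ≤ 2 ^ b * 32 * N ^ 3 := fun {a b} hab => by
    rw [Nat.mul_assoc]
    exact Nat.mul_le_mul (Nat.pow_le_pow_right (by norm_num) hab) (by omega)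
  have f1 : 2 ^ h * (P.sel.size + 8) ≤ Z :=
    (Nat.mul_le_mul_left _ hs).trans (hp (Nat.le_add_right h j))
  have f2 : 2 ^ j * (((SelCircuit.double true)^[h] P.sel).size + 8) ≤ Z := by
    refine le_trans (Nat.mul_le_mul_left _ (e1.trans (Nat.mul_le_mul_left _ hs))) ?_
    rw [← Nat.mul_assoc, ← pow_add, Nat.add_comm]
    exact hp le_rfl
  refine ((rep_double true h P.sel k f1).seq ((rep_double false j _ k f2).seq
    ((amplifyLoop k le_rfl W e4).seq (emitPair _)))).of_eq rfl ?_
  have g1 : ((SelCircuit.round^[k.size] W).size + 1) ^ 2 ≤ Z ^ 2 :=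
    Nat.pow_le_pow_left (by omega) 2
  have g2 : k.size ≤ N := by
    have := Nat.size_le.2 (Nat.lt_two_pow_self (n := k))
    omega
  have hN1 : 1 ≤ N := by omega
  have hZN : N ≤ Z ^ 2 := by
    have : N ≤ Z := hN3.trans (Nat.le_mul_of_pos_left _ (by positivity))
    exact this.trans (Nat.le_self_pow (by norm_num) Z)
  have g3 : k.size * (10000 * Z ^ 2 + 7 * k + 3) ≤ N * (10010 * Z ^ 2) :=
    Nat.mul_le_mul g2 (by omega)
  have g4 : Z ^ 2 ≤ N * Z ^ 2 := Nat.le_mul_of_pos_left _ hN1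
  have g5 : ampCost h j * N ^ 7 = (5000 * (h + j)) * (N * Z ^ 2) + 20000 * (N * Z ^ 2) := by
    simp only [ampCost, hZ]; ring
  have g6 : h * (5000 * Z ^ 2) + j * (5000 * Z ^ 2) ≤ (5000 * (h + j)) * (N * Z ^ 2) := by
    calc _ = (5000 * (h + j)) * Z ^ 2 := by ring
      _ ≤ _ := Nat.mul_le_mul_left _ g4
  rw [g5]
  have g7 : N * (10010 * Z ^ 2) = 10010 * (N * Z ^ 2) := by ring
  omega

theorem polyTime_amplifyPairParam (h j : ℕ) : PolyTime encodePairParam encodePair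
    fun I : CircuitPair × ℕ => (I.1.sel.amplified h j I.2).pair := by
  refine polyTime_of_runs (.amplifyPairParam h j)
    (Polynomial.C (ampCost h j + 2005) * Polynomial.X ^ 7) ?_
  rintro ⟨P, k⟩
  refine ((Runs.readPair P (encodeUnary k)).seq ((Runs.readNum (j := .kk) (p := k) (x := [])
    (by decide) (by simp)).seq ((Runs.amplify h j k P).of_eq_left ?_))).of_eq rfl ?_
  · simp [SelCircuit.mem]
  · have hl : (encodePairParam (P, k)).length = (encodePair P).length + k + 1 := by
      simp [encodePairParam, encodeUnary, Nat.add_assoc]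
    simp only [Polynomial.eval_mul, Polynomial.eval_C, Polynomial.eval_pow, Polynomial.eval_X, hl]
    set N := (encodePair P).length + k + 1 with hN
    have h1 : ((encodePair P).length + 1) ^ 2 ≤ N ^ 7 :=
      (Nat.pow_le_pow_left (by omega) 2).trans (Nat.pow_le_pow_right (by omega) (by norm_num))
    have h2 : N ≤ N ^ 7 := Nat.le_self_pow (by norm_num) N
    rw [Nat.add_mul]
    omega

/-- Here `k` is not part of the input; its ticks are hard-wired into the program, and it enters the
polynomial as a constant. -/
theorem polyTime_amplifyPair (h j k : ℕ) : PolyTime encodePair encodePair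
    fun P : CircuitPair => (P.sel.amplified h j k).pair := by
  refine polyTime_of_runs (.amplifyPair h j k)
    (Polynomial.C (ampCost h j + 2005) * (Polynomial.X + Polynomial.C (k + 1)) ^ 7) ?_
  intro P
  have hr := Runs.readPair P []
  rw [List.append_nil] at hr
  refine (hr.seq ((Runs.pushList .kk (ticks k) _).seq
    ((Runs.amplify h j k P).of_eq_left ?_))).of_eq rfl ?_
  · simp [SelCircuit.mem]
  · simp only [Polynomial.eval_mul, Polynomial.eval_C, Polynomial.eval_pow, Polynomial.eval_X,
      Polynomial.eval_add, List.length_replicate]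
    rw [show (encodePair P).length + (k + 1) = (encodePair P).length + k + 1 by omega]
    set N := (encodePair P).length + k + 1 with hN
    have h1 : ((encodePair P).length + 1) ^ 2 ≤ N ^ 7 :=
      (Nat.pow_le_pow_left (by omega) 2).trans (Nat.pow_le_pow_right (by omega) (by norm_num))
    have h2 : N ≤ N ^ 7 := Nat.le_self_pow (by norm_num) N
    rw [Nat.add_mul]
    omega

/-- Constant functions are computable in polynomial time. -/
theorem polyTime_const {α β : Type} (ea : α → List Letter) (eb : β → List Letter) (y : β) :
    PolyTime ea eb fun _ => y := by
  refine polyTime_of_runs (.constant (eb y))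
    (Polynomial.C 2 * Polynomial.X + Polynomial.C ((eb y).length + 2)) fun x => ?_
  refine ((Runs.clear .inp _).seq (Runs.pushList .out _ _)).of_eq ?_ ?_
  · simp
  · simp
    omega

/-! ### Evaluation of the constructed circuits -/

/-- The values of the nodes `L`, appended to the values `v` of earlier nodes. -/
def evalFrom {n : ℕ} (x : Fin n → Bool) (v : List Bool) (L : List (Node n)) : List Bool :=
  L.foldl (fun v g => v ++ [g.eval x v]) v

section evalFrom

variable {n : ℕ} (x : Fin n → Bool)

theorem evalFrom_cons (v : List Bool) (g : Node n) (L : List (Node n)) :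
    evalFrom x v (g :: L) = evalFrom x (v ++ [g.eval x v]) L := rfl

theorem evalFrom_append (v : List Bool) (L L' : List (Node n)) :
    evalFrom x v (L ++ L') = evalFrom x (evalFrom x v L) L' := List.foldl_append

theorem length_evalFrom (v : List Bool) (L : List (Node n)) :
    (evalFrom x v L).length = v.length + L.length := by
  induction L generalizing v with
  | nil => rfl
  | cons g L ih =>
    rw [evalFrom_cons, ih]
    simp
    omega

theorem getD_evalFrom {v : List Bool} {p : ℕ} (hp : p < v.length) (L : List (Node n)) :
    (evalFrom x v L).getD p false = v.getD p false := by
  induction L generalizing v with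
  | nil => rfl
  | cons g L ih =>
    rw [evalFrom_cons, ih (by simp; omega), List.getD_append _ _ _ _ hp]

theorem getD_append_add (u v : List Bool) {d : ℕ} (hd : u.length = d) (p : ℕ) :
    (u ++ v).getD (p + d) false = v.getD p false := by
  rw [List.getD_append_right _ _ _ _ (by omega)]
  congr 1
  omega

/-- A shifted gate reads `u ++ v` at `p + d`, which is `v` at `p`. This also holds out of range,
where both sides take the default value, so no condition on the positions is needed. -/
theorem evalFrom_shift {n' k d : ℕ} (hk : n + k ≤ n') {x' : Fin n' → Bool}
    (hx : ∀ i : Fin n, x' ⟨i + k, by omega⟩ = x i) {u : List Bool} (hu : u.length = d)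
    (v : List Bool) (L : List (Node n)) :
    evalFrom x' (u ++ v) (L.map (Node.shift k d hk)) = u ++ evalFrom x v L := by
  induction L generalizing v with
  | nil => rfl
  | cons g L ih =>
    have hg : (g.shift k d hk).eval x' (u ++ v) = g.eval x v := by
      rcases g with i | c | p | ⟨p, q⟩ | ⟨p, q⟩ <;>
        simp only [Node.shift, Node.eval, getD_append_add u v hu, hx]
    rw [List.map_cons, evalFrom_cons, hg, List.append_assoc, ih, evalFrom_cons]

/-- Each triple computes (¬c ∧ p) ∨ (c ∧ q), and later gates do not alter earlier values. The
induction absorbs the first triple into the list of known values. -/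
theorem getD_evalFrom_muxNodes {c : Bool} {A B : List ℕ} (hAB : A.length = B.length)
    {v : List Bool} (hv : 1 < v.length) (h0 : v.getD 0 false = c) (h1 : v.getD 1 false = !c)
    (hA : ∀ p ∈ A, p < v.length) (hB : ∀ p ∈ B, p < v.length) (i : ℕ) (hi : i < A.length) :
    (evalFrom x v (muxNodes v.length A B)).getD (v.length + 3 * i + 2) false =
      bif c then v.getD (B.getD i 0) false else v.getD (A.getD i 0) false := by
  induction A generalizing B v i with
  | nil => simp at hi
  | cons p A ih =>
    obtain _ | ⟨q, B⟩ := B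
    · simp at hAB
    · simp only [List.mem_cons, forall_eq_or_imp, List.length_cons] at hA hB hAB hi
      set w := evalFrom x v [.and 1 p, .and 0 q, .or v.length (v.length + 1)] with hw
      have e1 : evalFrom x v (muxNodes v.length (p :: A) (q :: B)) =
          evalFrom x w (muxNodes w.length A B) := by
        have : w.length = v.length + 3 := length_evalFrom ..
        rw [this]
        rfl
      have lw : w.length = v.length + 3 := length_evalFrom ..
      have ew : ∀ r, r < v.length → w.getD r false = v.getD r false :=
        fun r hr => getD_evalFrom x hr _
      rw [e1]
      obtain _ | i := i
      · rw [getD_evalFrom x (by omega)]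
        have e2 : w = v ++ [v.getD 1 false && v.getD p false, v.getD 0 false && v.getD q false,
            (v.getD 1 false && v.getD p false) || (v.getD 0 false && v.getD q false)] := by
          rw [hw]
          simp only [evalFrom_cons, Node.eval]
          rw [List.getD_append _ _ _ _ (by omega), List.getD_append _ _ _ _ hB.1]
          simp [evalFrom]
        rw [e2, List.getD_append_right _ _ _ _ (by omega), h0, h1]
        cases c <;> simp
      · have := ih (B := B) (v := w) (by omega) (by omega) (by rw [ew _ (by omega), h0])
          (by rw [ew _ hv, h1]) (fun r hr => by have := hA.2 r hr; omega)
          (fun r hr => by have := hB.2 r hr; omega) i (by omega)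
        rw [show v.length + 3 * (i + 1) + 2 = w.length + 3 * i + 2 by omega, this]
        have lB : i < B.length := by omega
        have lA : i < A.length := by omega
        rw [ew _ ?_, ew _ ?_]
        · simp
        · rw [List.getD_eq_getElem _ _ lA]
          exact hA.2 _ (List.getElem_mem lA)
        · rw [List.getD_eq_getElem _ _ lB]
          exact hB.2 _ (List.getElem_mem lB)

end evalFrom

theorem CircuitPair.sel_eval (P : CircuitPair) (c : Bool) :
    (P.sel.circuit c).eval = if c then P.Y.eval else P.X.eval := by
  refine funext fun (x : Fin P.n → Bool) => funext fun (o : Fin P.m) => ?_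
  have e1 : (P.sel.circuit c).values x = evalFrom x (([c, !c] ++ P.X.values x) ++ P.Y.values x)
      (muxNodes (2 + P.X.nodes.length + P.Y.nodes.length) P.outsX P.outsY) := by
    change evalFrom x [c, !c] (P.X.nodes.map (Node.shift (n' := P.n) 0 2 le_rfl) ++
      (P.Y.nodes.map (Node.shift (n' := P.n) 0 (2 + P.X.nodes.length) le_rfl) ++ _)) = _
    rw [evalFrom_append, evalFrom_append]
    have := evalFrom_shift x (n' := P.n) (x' := x) (k := 0) le_rfl (fun i => rfl)
      (u := [c, !c]) (d := 2) rfl [] P.X.nodes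
    rw [List.append_nil] at this
    rw [this]
    have := evalFrom_shift x (n' := P.n) (x' := x) (k := 0) le_rfl (fun i => rfl)
      (u := [c, !c] ++ evalFrom x [] P.X.nodes) (d := 2 + P.X.nodes.length)
      (by simp [length_evalFrom]; omega) [] P.Y.nodes
    rw [List.append_nil] at this
    rw [this]
    rfl
  have lX : (P.X.values x).length = P.X.nodes.length := by
    exact (length_evalFrom x [] P.X.nodes).trans (Nat.zero_add _)
  have lY : (P.Y.values x).length = P.Y.nodes.length := by
    exact (length_evalFrom x [] P.Y.nodes).trans (Nat.zero_add _)
  have hX := P.X.outputs_lt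
  have hY := P.Y.outputs_lt
  set v := ([c, !c] ++ P.X.values x) ++ P.Y.values x with hv
  have lv : v.length = 2 + P.X.nodes.length + P.Y.nodes.length := by
    simp [hv, lX, lY]
    omega
  have key := getD_evalFrom_muxNodes x (A := P.outsX) (B := P.outsY) (c := c) (v := v)
    (by simp [outsX, outsY]) (by omega) (by simp [hv]) (by simp [hv]) ?_ ?_ o (by simp [outsX])
  · change ((P.sel.circuit c).values x).getD
      (2 + P.X.nodes.length + P.Y.nodes.length + 3 * o + 2) false = _
    rw [e1, ← lv, key]
    have eX : P.outsX.getD o 0 = P.X.outputs o + 2 := by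
      rw [List.getD_eq_getElem _ _ (by simp [outsX])]
      simp [outsX]
    have eY : P.outsY.getD o 0 = P.Y.outputs o + (2 + P.X.nodes.length) := by
      rw [List.getD_eq_getElem _ _ (by simp [outsY])]
      simp [outsY]
    cases c
    · simp only [cond_false, eX]
      rw [hv, List.getD_append _ _ _ _ (by simp [lX]; exact hX o), getD_append_add (d := 2) _ _ rfl]
      rfl
    · simp only [cond_true, eY]
      rw [hv, getD_append_add _ _ (by simp [lX]; omega)]
      rfl
  · intro p hp
    simp only [outsX, List.mem_map, List.mem_ofFn] at hp
    obtain ⟨_, ⟨o, rfl⟩, rfl⟩ := hp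
    have := hX o
    omega
  · intro p hp
    simp only [outsY, List.mem_map, List.mem_ofFn] at hp
    obtain ⟨_, ⟨o, rfl⟩, rfl⟩ := hp
    have := hY o
    omega

theorem SelCircuit.double_eval (x : Bool) (W : SelCircuit) (c t : Bool) (r r' : Fin W.n → Bool) :
    ((W.double x).circuit c).eval (Fin.cons t (Fin.append r r') : Fin (W.n + W.n + 1) → Bool) =
      Fin.append ((W.circuit (bif x then t else c)).eval r)
        ((W.circuit (bif x then xor c t else c)).eval r') := by
  set z : Fin (W.n + W.n + 1) → Bool := Fin.cons t (Fin.append r r') with hz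
  -- The values of the selector and of the five header gates; the last one is c ⊕ t.
  set hd : List Bool := [c, t, c && t, !(c && t), c || t, !(c && t) && (c || t)] with hhd
  set a := bif x then t else c
  set b := bif x then xor c t else c
  have e1 : ((W.double x).circuit c).values z =
      (hd ++ evalFrom r [a] W.body) ++ evalFrom r' [b] W.body := by
    change evalFrom z [c] (xorHeader W.n ++ _ ++ _) = _
    rw [evalFrom_append, evalFrom_append]
    have h1 : evalFrom z [c] (xorHeader W.n) = hd := rfl
    rw [h1, evalFrom_cons z hd]
    have h2 : (Node.or (selA x) (selA x) : Node (W.n + W.n + 1)).eval z hd = a := by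
      cases x <;> simp [selA, Node.eval, hhd, a]
    rw [h2, evalFrom_shift r (by omega) ?_ (by rfl), evalFrom_cons]
    · have h3 : (Node.or (selB x) (selB x) : Node (W.n + W.n + 1)).eval z
          (hd ++ evalFrom r [a] W.body) = b := by
        cases x <;> simp [selB, Node.eval, hhd, b]
        cases c <;> cases t <;> rfl
      rw [h3, evalFrom_shift r' (by omega) ?_ ?_]
      · intro i
        have : (⟨i + (W.n + 1), by omega⟩ : Fin (W.n + W.n + 1)) = (Fin.natAdd W.n i).succ := by
          ext; simp; omega
        rw [this, hz, Fin.cons_succ, Fin.append_right]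
      · simp [hhd, length_evalFrom]; omega
    · intro i
      have : (⟨i + 1, by omega⟩ : Fin (W.n + W.n + 1)) = (Fin.castAdd W.n i).succ := by
        ext; simp
      rw [this, hz, Fin.cons_succ, Fin.append_left]
  refine funext fun (o : Fin (W.m + W.m)) => ?_
  change (((W.double x).circuit c).values z).getD (Fin.append (fun o => W.outs o + 6)
    (fun o => W.outs o + (W.body.length + 7)) o) false = _
  rw [e1]
  refine Fin.addCases (fun i => ?_) (fun i => ?_) o
  · have := W.outs_lt i
    rw [Fin.append_left, Fin.append_left,
      List.getD_append _ _ _ _ (by simp [hhd, length_evalFrom]; omega), getD_append_add (d := 6) _ _ rfl]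
    rfl
  · rw [Fin.append_right, Fin.append_right,
      getD_append_add _ _ (by simp [hhd, length_evalFrom]; omega)]
    rfl

/-! ### Statistical difference and disjointness of the constructed circuits -/

/-- The average over the cube. -/
noncomputable def avg {n : ℕ} (f : (Fin n → Bool) → ℝ) : ℝ := (∑ x, f x) / 2 ^ n

open Classical in
/-- The indicator of a proposition. -/
noncomputable def ind (p : Prop) : ℝ := if p then 1 else 0

theorem ind_and (p q : Prop) : ind (p ∧ q) = ind p * ind q := by
  by_cases hp : p <;> by_cases hq : q <;> simp [ind, hp, hq]

theorem avg_mono {n : ℕ} {f g : (Fin n → Bool) → ℝ} (h : ∀ x, f x ≤ g x) : avg f ≤ avg g := by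
  unfold avg
  gcongr with x
  exact h x

theorem avg_mul_avg {n : ℕ} (f g : (Fin n → Bool) → ℝ) :
    avg (fun r => avg fun r' => f r * g r') = avg f * avg g := by
  simp only [avg, ← Finset.mul_sum, mul_div_assoc, ← Finset.sum_mul]
  ring

theorem avg_one_sub {n : ℕ} (f : (Fin n → Bool) → ℝ) : avg (fun r => 1 - f r) = 1 - avg f := by
  simp only [avg, Finset.sum_sub_distrib, sub_div]
  simp

theorem avg_cons_append {n : ℕ} (f : (Fin (n + n + 1) → Bool) → ℝ) :
    avg f = (avg (fun r => avg fun r' => f (Fin.cons false (Fin.append r r'))) +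
      avg (fun r => avg fun r' => f (Fin.cons true (Fin.append r r')))) / 2 := by
  have h : ∑ z, f z = ∑ t : Bool, ∑ r : Fin n → Bool, ∑ r' : Fin n → Bool,
      f (Fin.cons t (Fin.append r r')) := by
    rw [← Equiv.sum_comp (Fin.consEquiv fun _ => Bool), Fintype.sum_prod_type]
    refine Finset.sum_congr rfl fun t _ => ?_
    rw [← Equiv.sum_comp (Fin.appendEquiv n n), Fintype.sum_prod_type]
    rfl
  simp only [avg, h, Fintype.sum_bool, ← Finset.sum_div]
  ring

namespace Circuit

variable {n m : ℕ}

theorem prob_eq_avg (C : Circuit n m) (y : Fin m → Bool) :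
    C.prob y = avg fun x => ind (C.eval x = y) := by
  simp only [prob, avg, ind, Finset.card_filter, Nat.cast_sum]
  congr 1
  refine Finset.sum_congr rfl fun x _ => ?_
  split_ifs <;> simp

theorem prob_nonneg (C : Circuit n m) (y : Fin m → Bool) : 0 ≤ C.prob y := by
  unfold prob
  positivity

theorem sum_prob (C : Circuit n m) : ∑ y, C.prob y = 1 := by
  simp only [prob_eq_avg, avg, ← Finset.sum_div]
  rw [Finset.sum_comm]
  have h : ∀ x, ∑ y, ind (C.eval x = y) = 1 := by
    intro x
    exact (Finset.sum_eq_single (C.eval x) (fun y _ hy => by simp [ind, hy.symm])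
      (by simp)).trans (by simp [ind])
  simp [h]

end Circuit

/-- Passing to the collision event is useful because for a product it is the conjunction of
collisions in the two components, and its probability factors. -/
theorem Disj_eq_avg {n m : ℕ} (X Y : Circuit n m) :
    Disj X Y = 1 - avg fun x => ind (∃ j, X.eval x = Y.eval j) := by
  rw [← avg_one_sub]
  simp only [Disj, avg, Finset.card_filter, Nat.cast_sum]
  congr 1
  refine Finset.sum_congr rfl fun x _ => ?_
  by_cases h : ∃ j, X.eval x = Y.eval j
  · have h' : ¬ ∀ j, X.eval x ≠ Y.eval j := by simpa using h
    simp [ind, h, h']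
  · have h' : ∀ j, X.eval x ≠ Y.eval j := by simpa using h
    simp [ind, h']

theorem SD_nonneg {n m : ℕ} (X Y : Circuit n m) : 0 ≤ SD X Y := by
  unfold SD
  positivity

theorem SD_le_one {n m : ℕ} (X Y : Circuit n m) : SD X Y ≤ 1 := by
  have h : ∑ y, |X.prob y - Y.prob y| ≤ ∑ y, (X.prob y + Y.prob y) :=
    Finset.sum_le_sum fun y _ => by
      rw [abs_le]
      constructor <;> linarith [X.prob_nonneg y, Y.prob_nonneg y]
  rw [Finset.sum_add_distrib, X.sum_prob, Y.sum_prob] at h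
  unfold SD
  linarith

theorem SD_congr {n m : ℕ} {X Y X' Y' : Circuit n m} (hX : X.eval = X'.eval)
    (hY : Y.eval = Y'.eval) : SD X Y = SD X' Y' := by
  simp only [SD, Circuit.prob, hX, hY]

theorem Disj_congr {n m : ℕ} {X Y X' Y' : Circuit n m} (hX : X.eval = X'.eval)
    (hY : Y.eval = Y'.eval) : Disj X Y = Disj X' Y' := by
  simp only [Disj, hX, hY]

/-! ### Effect of the two doublings on statistical difference and disjointness -/

namespace SelCircuit

/-- The statistical difference of the two circuits given by the selector. -/
noncomputable def sd (W : SelCircuit) : ℝ := SD (W.circuit false) (W.circuit true)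

/-- The disjointness from the circuit with the other selector. -/
noncomputable def disj (W : SelCircuit) (c : Bool) : ℝ := Disj (W.circuit c) (W.circuit !c)

theorem append_eq_append_iff {m : ℕ} {u v y z : Fin m → Bool} :
    Fin.append u v = Fin.append y z ↔ u = y ∧ v = z := by
  rw [← Prod.mk_inj]
  exact (Fin.appendEquiv m m).injective.eq_iff (a := (u, v)) (b := (y, z))

/-- Conditioned on the random bit t, the two components are independent; the two values of t are
then averaged. -/
theorem prob_double (x : Bool) (W : SelCircuit) (c : Bool) (y z : Fin W.m → Bool) :
    ((W.double x).circuit c).prob (Fin.append y z : Fin (W.m + W.m) → Bool) =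
      ((W.circuit (bif x then false else c)).prob y * (W.circuit c).prob z +
        (W.circuit (bif x then true else c)).prob y *
          (W.circuit (bif x then !c else c)).prob z) / 2 := by
  have key : ∀ t : Bool, avg (fun r => avg fun r' =>
      ind (((W.double x).circuit c).eval
        (Fin.cons t (Fin.append r r') : Fin (W.n + W.n + 1) → Bool) =
        (Fin.append y z : Fin (W.m + W.m) → Bool))) =
      (W.circuit (bif x then t else c)).prob y *
        (W.circuit (bif x then xor c t else c)).prob z := by
    intro t
    rw [Circuit.prob_eq_avg, Circuit.prob_eq_avg, ← avg_mul_avg]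
    congr 1
    funext r
    congr 1
    funext r'
    rw [double_eval]
    exact (congrArg ind (propext append_eq_append_iff)).trans (ind_and _ _)
  refine (Circuit.prob_eq_avg _ _).trans ((avg_cons_append _).trans ?_)
  rw [key, key]
  cases x <;> simp

theorem sd_double (x : Bool) (W : SelCircuit) : (W.double x).sd =
    (1 / 2) * ∑ y, ∑ z, |((W.double x).circuit false).prob
      (Fin.append y z : Fin (W.m + W.m) → Bool) -
      ((W.double x).circuit true).prob (Fin.append y z : Fin (W.m + W.m) → Bool)| := by
  unfold sd SD
  congr 1
  refine (Equiv.sum_comp (Fin.appendEquiv W.m W.m) _).symm.trans ?_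
  rw [Fintype.sum_prod_type]
  rfl

/-- With p and q the two distributions, the new ones are (p⊗p + q⊗q)/2 and (p⊗q + q⊗p)/2. Their
difference is (p - q)⊗(p - q)/2, whose ℓ¹ norm factors. -/
theorem sd_double_true (W : SelCircuit) : (W.double true).sd = W.sd ^ 2 := by
  rw [sd_double]
  have : ∀ y z, |((W.double true).circuit false).prob (Fin.append y z : Fin (W.m + W.m) → Bool) -
      ((W.double true).circuit true).prob (Fin.append y z : Fin (W.m + W.m) → Bool)| =
      (1 / 2) * (|(W.circuit false).prob y - (W.circuit true).prob y| *
        |(W.circuit false).prob z - (W.circuit true).prob z|) := by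
    intro y z
    rw [prob_double, prob_double, ← abs_mul,
      show (1 / 2 : ℝ) = |1 / 2| from (abs_of_pos (by norm_num)).symm, ← abs_mul]
    congr 1
    simp
    ring
  simp only [this, ← Finset.mul_sum, ← Finset.sum_mul]
  unfold sd SD
  ring

/-- A hybrid argument: p⊗p - q⊗q = p⊗(p - q) + (p - q)⊗q, and p and q have total mass 1. -/
theorem sd_double_false (W : SelCircuit) : (W.double false).sd ≤ 2 * W.sd := by
  rw [sd_double]
  set p := (W.circuit false).prob
  set q := (W.circuit true).prob
  have h : ∀ y z, |((W.double false).circuit false).prob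
      (Fin.append y z : Fin (W.m + W.m) → Bool) - ((W.double false).circuit true).prob
      (Fin.append y z : Fin (W.m + W.m) → Bool)| ≤ p y * |p z - q z| + |p y - q y| * q z := by
    intro y z
    rw [prob_double, prob_double]
    have e : ∀ a b : ℝ, (a * b + a * b) / 2 = a * b := fun a b => by ring
    simp only [cond_false, e]
    calc |p y * p z - q y * q z| = |p y * (p z - q z) + (p y - q y) * q z| := by congr 1; ring
      _ ≤ |p y * (p z - q z)| + |(p y - q y) * q z| := abs_add_le _ _
      _ = _ := by
        rw [abs_mul, abs_mul, abs_of_nonneg ((W.circuit false).prob_nonneg y),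
          abs_of_nonneg ((W.circuit true).prob_nonneg z)]
  have h2 := Finset.sum_le_sum fun y (_ : y ∈ Finset.univ) =>
    Finset.sum_le_sum fun z (_ : z ∈ Finset.univ) => h y z
  simp only [Finset.sum_add_distrib, ← Finset.mul_sum, ← Finset.sum_mul] at h2
  rw [show ∑ y, p y = 1 from Circuit.sum_prob _, show ∑ y, q y = 1 from Circuit.sum_prob _] at h2
  unfold sd SD
  linarith

theorem exists_fin_cons_append {n : ℕ} {f : (Fin (n + n + 1) → Bool) → Prop} :
    (∃ z, f z) ↔ ∃ (t : Bool) (r r' : Fin n → Bool), f (Fin.cons t (Fin.append r r')) := by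
  constructor
  · rintro ⟨z, hz⟩
    refine ⟨z 0, ((Fin.appendEquiv n n).symm (Fin.tail z)).1,
      ((Fin.appendEquiv n n).symm (Fin.tail z)).2, ?_⟩
    have : Fin.append ((Fin.appendEquiv n n).symm (Fin.tail z)).1
      ((Fin.appendEquiv n n).symm (Fin.tail z)).2 = Fin.tail z :=
      (Fin.appendEquiv n n).apply_symm_apply _
    rwa [this, Fin.cons_self_tail]
  · rintro ⟨t, r, r', h⟩
    exact ⟨_, h⟩

/-- A pair of outputs is hit by the other product exactly when both components are hit, and these
events are independent. The additional random bit is ignored. -/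
theorem disj_double_false (W : SelCircuit) (c : Bool) :
    1 - (W.double false).disj c = (1 - W.disj c) ^ 2 := by
  classical
  unfold disj
  rw [Disj_eq_avg, Disj_eq_avg, sub_sub_cancel, sub_sub_cancel, pow_two, ← avg_mul_avg]
  refine (avg_cons_append _).trans ?_
  have key : ∀ t : Bool, ∀ r r' : Fin W.n → Bool,
      (∃ j, ((W.double false).circuit c).eval
        (Fin.cons t (Fin.append r r') : Fin (W.n + W.n + 1) → Bool) =
        ((W.double false).circuit !c).eval j) ↔
      (∃ j, (W.circuit c).eval r = (W.circuit !c).eval j) ∧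
        ∃ j, (W.circuit c).eval r' = (W.circuit !c).eval j := by
    intro t r r'
    refine exists_fin_cons_append.trans ?_
    simp only [double_eval, cond_false]
    constructor
    · rintro ⟨_, s, s', h⟩
      obtain ⟨h1, h2⟩ := append_eq_append_iff.1 h
      exact ⟨⟨s, h1⟩, ⟨s', h2⟩⟩
    · rintro ⟨⟨s, h1⟩, ⟨s', h2⟩⟩
      exact ⟨false, s, s', append_eq_append_iff.2 ⟨h1, h2⟩⟩
  simp only [key, ind_and]
  rw [add_self_div_two]

/-- Suppose (W(t, r), W(c ⊕ t, r')) is also produced under selector ¬c with bit t'. If t' ≠ t, the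
first component is hit by the opposite selector; if t' = t, the second is. So the pair is missed
whenever both components are missed, and these are independent for given t. -/
theorem disj_double_true (W : SelCircuit) (c : Bool) :
    (W.disj false * W.disj c + W.disj true * W.disj !c) / 2 ≤ (W.double true).disj c := by
  classical
  have e : ∀ d, W.disj d =
      avg fun r => 1 - ind (∃ j, (W.circuit d).eval r = (W.circuit !d).eval j) := by
    intro d
    rw [avg_one_sub]
    exact Disj_eq_avg _ _
  have e' : (W.double true).disj c = _ :=
    (Disj_eq_avg _ _).trans (avg_one_sub _).symm
  rw [e', e, e, e, e, ← avg_mul_avg, ← avg_mul_avg]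
  refine le_trans ?_ (avg_cons_append _).ge
  have key : ∀ t : Bool, ∀ r r' : Fin W.n → Bool,
      (∃ j, ((W.double true).circuit c).eval
        (Fin.cons t (Fin.append r r') : Fin (W.n + W.n + 1) → Bool) =
        ((W.double true).circuit !c).eval j) →
      (∃ j, (W.circuit t).eval r = (W.circuit !t).eval j) ∨
        ∃ j, (W.circuit (xor c t)).eval r' = (W.circuit !(xor c t)).eval j := by
    intro t r r' h
    obtain ⟨t', s, s', h⟩ := exists_fin_cons_append.1 h
    simp only [double_eval, cond_true] at h
    obtain ⟨h1, h2⟩ := append_eq_append_iff.1 h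
    by_cases ht : t' = t
    · subst ht
      refine Or.inr ⟨s', h2.trans ?_⟩
      rw [Bool.not_xor]
    · refine Or.inl ⟨s, h1.trans ?_⟩
      rw [show t' = !t by cases t <;> cases t' <;> simp_all]
  have key2 : ∀ t : Bool, ∀ r r' : Fin W.n → Bool,
      (1 - ind (∃ j, (W.circuit t).eval r = (W.circuit !t).eval j)) *
      (1 - ind (∃ j, (W.circuit (xor c t)).eval r' = (W.circuit !(xor c t)).eval j)) ≤
      1 - ind (∃ j, ((W.double true).circuit c).eval
        (Fin.cons t (Fin.append r r') : Fin (W.n + W.n + 1) → Bool) =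
        ((W.double true).circuit !c).eval j) := by
    intro t r r'
    have := key t r r'
    unfold ind
    split_ifs <;> simp_all
  have h1 := avg_mono fun r => avg_mono fun r' => key2 false r r'
  have h2 := avg_mono fun r => avg_mono fun r' => key2 true r r'
  simp only [Bool.xor_false, Bool.xor_true] at h1 h2
  linarith

end SelCircuit

/-! ### Amplification -/

namespace SelCircuit

theorem disj_le_one (W : SelCircuit) (c : Bool) : W.disj c ≤ 1 :=
  (Disj_le_SD _ _).trans (SD_le_one _ _)

theorem sd_nonneg (W : SelCircuit) : 0 ≤ W.sd := SD_nonneg _ _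

theorem sd_iterate_double_true (h : ℕ) (W : SelCircuit) :
    ((double true)^[h] W).sd = W.sd ^ 2 ^ h := by
  induction h generalizing W with
  | zero => simp
  | succ h ih => rw [Function.iterate_succ_apply, ih, sd_double_true, ← pow_mul, pow_succ']

theorem sd_iterate_double_false (j : ℕ) (W : SelCircuit) :
    ((double false)^[j] W).sd ≤ 2 ^ j * W.sd := by
  induction j generalizing W with
  | zero => simp
  | succ j ih =>
    rw [Function.iterate_succ_apply]
    refine (ih _).trans ?_
    rw [pow_succ, mul_assoc]
    exact mul_le_mul_of_nonneg_left W.sd_double_false (by positivity)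

/-- Since XOR mixes the disjointnesses of both selectors, the bound must hold for both; this is
where mutual disjointness enters. -/
theorem sq_le_disj_double_true {W : SelCircuit} {b : ℝ} (hb : 0 ≤ b) (h : ∀ c, b ≤ W.disj c)
    (c : Bool) : b ^ 2 ≤ (W.double true).disj c := by
  refine le_trans ?_ (W.disj_double_true c)
  have h1 := mul_le_mul (h false) (h c) hb (hb.trans (h false))
  have h2 := mul_le_mul (h true) (h !c) hb (hb.trans (h true))
  linarith [sq b]

theorem pow_le_disj_iterate_double_true (n : ℕ) {W : SelCircuit} {b : ℝ} (hb : 0 ≤ b)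
    (h : ∀ c, b ≤ W.disj c) (c : Bool) : b ^ 2 ^ n ≤ ((double true)^[n] W).disj c := by
  induction n generalizing W b with
  | zero => simpa using h c
  | succ n ih =>
    rw [Function.iterate_succ_apply, pow_succ', pow_mul]
    exact ih (by positivity) (sq_le_disj_double_true hb h)

theorem one_sub_disj_iterate_double_false (j : ℕ) (W : SelCircuit) (c : Bool) :
    1 - ((double false)^[j] W).disj c = (1 - W.disj c) ^ 2 ^ j := by
  induction j generalizing W with
  | zero => simp
  | succ j ih => rw [Function.iterate_succ_apply, ih, disj_double_false, ← pow_mul, pow_succ']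

/-- XOR gives u²/16 and the product then at most u²/8. The factor 1/4 is kept for uniformity with
`one_sub_disj_round`, where it is needed. -/
theorem sd_round {W : SelCircuit} {u : ℝ} (h : W.sd ≤ u / 4) : W.round.sd ≤ u ^ 2 / 4 := by
  have h1 := (W.double true).sd_double_false
  rw [sd_double_true] at h1
  have h2 := pow_le_pow_left₀ W.sd_nonneg h 2
  unfold round
  nlinarith [sq_nonneg u]

/-- XOR gives 1 - (1 - u/4)² ≤ u/2, and the product squares this to u²/4. -/
theorem one_sub_disj_round {W : SelCircuit} {u : ℝ} (hu : u ≤ 1)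
    (h : ∀ c, 1 - W.disj c ≤ u / 4) (c : Bool) : 1 - W.round.disj c ≤ u ^ 2 / 4 := by
  have h1 := sq_le_disj_double_true (W := W) (b := 1 - u / 4) (by linarith)
    (fun c => by linarith [h c]) c
  unfold round
  rw [disj_double_false]
  have h2 := (W.double true).disj_le_one c
  have h3 : 1 - (W.double true).disj c ≤ u / 2 := by nlinarith [sq_nonneg u]
  have h4 := pow_le_pow_left₀ (by linarith) h3 2
  linarith [show (u / 2) ^ 2 = u ^ 2 / 4 by ring]

theorem sd_iterate_round (t : ℕ) {W : SelCircuit} {u : ℝ} (h : W.sd ≤ u / 4) :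
    (round^[t] W).sd ≤ u ^ 2 ^ t / 4 := by
  induction t generalizing W u with
  | zero => simpa using h
  | succ t ih =>
    rw [Function.iterate_succ_apply, pow_succ', pow_mul]
    exact ih (sd_round h)

theorem one_sub_disj_iterate_round (t : ℕ) {W : SelCircuit} {u : ℝ} (h0 : 0 ≤ u) (hu : u ≤ 1)
    (h : ∀ c, 1 - W.disj c ≤ u / 4) (c : Bool) : 1 - (round^[t] W).disj c ≤ u ^ 2 ^ t / 4 := by
  induction t generalizing W u with
  | zero => simpa using h c
  | succ t ih =>
    rw [Function.iterate_succ_apply, pow_succ', pow_mul]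
    exact ih (by positivity) (pow_le_one₀ h0 hu) (one_sub_disj_round hu h)

end SelCircuit

/-- `k.size` rounds suffice because `k < 2 ^ k.size`. -/
theorem half_pow_two_pow_size_le (k : ℕ) : (1 / 2 : ℝ) ^ 2 ^ k.size / 4 ≤ 1 / 2 ^ k := by
  have h1 : (1 / 2 : ℝ) ^ 2 ^ k.size ≤ (1 / 2) ^ k :=
    pow_le_pow_of_le_one (by norm_num) (by norm_num) k.lt_size_self.le
  rw [← one_div_pow]
  have : (0 : ℝ) ≤ (1 / 2) ^ 2 ^ k.size := by positivity
  linarith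

/-- Bernoulli's inequality, for small bases. -/
theorem one_sub_pow_le {y : ℝ} (h0 : 0 ≤ y) (h1 : y ≤ 1) (n : ℕ) :
    (1 - y) ^ n ≤ 1 / (1 + n * y) := by
  rw [le_div_iff₀ (by positivity)]
  calc (1 - y) ^ n * (1 + n * y) ≤ (1 - y) ^ n * (1 + y) ^ n :=
        mul_le_mul_of_nonneg_left (one_add_mul_le_pow (by linarith) n)
          (pow_nonneg (by linarith) n)
    _ = (1 - y ^ 2) ^ n := by rw [← mul_pow]; ring
    _ ≤ 1 := pow_le_one₀ (by nlinarith) (by nlinarith)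

/-- The number of repetitions that separates two constants. -/
theorem exists_separating_powers {α β : ℝ} (h0 : 0 < α) (hαβ : α < β) (hβ : β ≤ 1) :
    ∃ h j : ℕ, 2 ^ j * α ^ 2 ^ h ≤ 1 / 8 ∧ (1 - β ^ 2 ^ h) ^ 2 ^ j ≤ 1 / 8 := by
  have hr : 1 < β / α := (one_lt_div h0).2 hαβ
  -- 112 = 16 · 7. With A and B the powers of α and β, j is taken below with 2^j ≤ 1/(8A) < 2^(j+1).
  -- Then 2^j A ≤ 1/8, while 2^j A > 1/16 gives 2^j B ≥ 7, and `one_sub_pow_le` bounds (1 - B)^(2^j)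
  -- by 1/(1 + 7).
  obtain ⟨h, hh⟩ := pow_unbounded_of_one_lt 112 hr
  have hh' : 112 * α ^ 2 ^ h ≤ β ^ 2 ^ h := by
    have h1 : (112 : ℝ) ≤ (β / α) ^ 2 ^ h :=
      hh.le.trans (pow_le_pow_right₀ hr.le Nat.lt_two_pow_self.le)
    rwa [div_pow, le_div_iff₀ (by positivity)] at h1
  have hA : 0 < α ^ 2 ^ h := by positivity
  have hB : β ^ 2 ^ h ≤ 1 := pow_le_one₀ (h0.trans hαβ).le hβ
  have hB0 : 0 < β ^ 2 ^ h := by linarith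
  refine ⟨h, ?_⟩
  generalize α ^ 2 ^ h = A at *
  generalize β ^ 2 ^ h = B at *
  obtain ⟨j, hj, hj'⟩ := exists_nat_pow_near (x := 1 / (8 * A)) (y := 2)
    (by rw [le_div_iff₀ (by positivity)]; linarith) (by norm_num)
  refine ⟨j, ?_, ?_⟩
  · rw [le_div_iff₀ (by positivity)] at hj
    linarith
  · rw [div_lt_iff₀ (by positivity), pow_succ] at hj'
    have h2 : 7 ≤ 2 ^ j * B := by
      have : (2 : ℝ) ^ j * (112 * A) ≤ 2 ^ j * B := mul_le_mul_of_nonneg_left hh' (by positivity)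
      linarith
    refine (one_sub_pow_le hB0.le hB _).trans ?_
    apply one_div_le_one_div_of_le (by norm_num)
    push_cast
    linarith

theorem CircuitPair.sd_sel (P : CircuitPair) : P.sel.sd = SD P.X P.Y :=
  SD_congr (P.sel_eval false) (P.sel_eval true)

theorem CircuitPair.mutDisj_le_disj_sel (P : CircuitPair) (c : Bool) :
    mutDisj P.X P.Y ≤ P.sel.disj c := by
  cases c
  · exact (min_le_left _ _).trans (Disj_congr (P.sel_eval false) (P.sel_eval true)).ge
  · exact (min_le_right _ _).trans (Disj_congr (P.sel_eval true) (P.sel_eval false)).ge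

/-- The amplified circuits polarize, with numbers of repetitions that depend only on the constants
of the problem. -/
theorem exists_amplified_mapsInstances {α β : ℝ} (h0 : 0 < α) (hαβ : α < β) (hβ : β ≤ 1) :
    ∃ h j : ℕ, ∀ k : ℕ, MapsInstances (mutIID α β) (mutIID (1 / 2 ^ k) (1 - 1 / 2 ^ k))
      fun P => (P.sel.amplified h j k).pair := by
  obtain ⟨h, j, h1, h2⟩ := exists_separating_powers h0 hαβ hβ
  refine ⟨h, j, fun k => ⟨fun P hP => ?_, fun P hP => ?_⟩⟩
  · replace hP : P.sel.sd ≤ α := P.sd_sel.trans_le hP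
    change (P.sel.amplified h j k).sd ≤ 1 / 2 ^ k
    -- The bound 1/8 reached after the first two phases is u/4 for u = 1/2.
    refine (SelCircuit.sd_iterate_round (u := 1 / 2) _ ?_).trans (half_pow_two_pow_size_le k)
    refine (SelCircuit.sd_iterate_double_false _ _).trans ?_
    rw [SelCircuit.sd_iterate_double_true]
    refine le_trans ?_ (h1.trans (by norm_num))
    gcongr
    exact P.sel.sd_nonneg
  · replace hP : ∀ c, β ≤ P.sel.disj c := fun c => le_trans hP (P.mutDisj_le_disj_sel c)
    have key : ∀ c, 1 - 1 / 2 ^ k ≤ (P.sel.amplified h j k).disj c := by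
      intro c
      have := (SelCircuit.one_sub_disj_iterate_round k.size (u := 1 / 2)
        (W := (SelCircuit.double false)^[j] ((SelCircuit.double true)^[h] P.sel)) (by norm_num)
        (by norm_num) (fun c => ?_) c).trans (half_pow_two_pow_size_le k)
      · unfold SelCircuit.amplified
        linarith
      · rw [SelCircuit.one_sub_disj_iterate_double_false]
        refine le_trans ?_ (h2.trans (by norm_num))
        have h3 := SelCircuit.pow_le_disj_iterate_double_true h (h0.trans hαβ).le hP c
        have h4 := ((SelCircuit.double true)^[h] P.sel).disj_le_one c
        exact pow_le_pow_left₀ (by linarith) (by linarith) _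
    exact le_min (key false) (key true)

/-- A circuit that returns its selector. -/
def selectorCircuit : SelCircuit where
  n := 0
  m := 1
  body := []
  outs := fun _ => 0
  predsLt := trivial
  outs_lt := by simp

theorem disj_selectorCircuit (c : Bool) : selectorCircuit.disj c = 1 := by
  have h : ∀ (c : Bool) (x : Fin 0 → Bool),
      (selectorCircuit.circuit c).eval x = (fun _ => c : Fin 1 → Bool) := fun c x => rfl
  have h' : ∀ i j : Fin 0 → Bool,
      (selectorCircuit.circuit c).eval i ≠ (selectorCircuit.circuit !c).eval j := by
    intro i j e
    have := congrFun ((h c i).symm.trans (e.trans (h (!c) j))) 0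
    simp at this
  unfold SelCircuit.disj Disj
  have e : (Finset.univ.filter fun i : Fin selectorCircuit.n → Bool => ∀ j,
    (selectorCircuit.circuit c).eval i ≠ (selectorCircuit.circuit !c).eval j) = Finset.univ :=
    Finset.filter_true_of_mem fun i _ => h' i
  rw [e]
  simp

/-- If all pairs are Yes instances, a constant map is a reduction. -/
theorem mapsInstances_const_yes {a b : ℝ} (ha : 1 ≤ a) (hab : a < b) (k : ℕ) :
    MapsInstances (mutIID a b) (mutIID (1 / 2 ^ k) (1 - 1 / 2 ^ k))
      fun _ => ⟨0, 1, selectorCircuit.circuit false, selectorCircuit.circuit false⟩ := by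
  refine ⟨fun P _ => ?_, fun P hP => ?_⟩
  · change SD (selectorCircuit.circuit false) (selectorCircuit.circuit false) ≤ 1 / 2 ^ k
    simp [SD]
  · have h1 : b ≤ mutDisj P.X P.Y := hP
    have h2 : mutDisj P.X P.Y ≤ 1 :=
      (min_le_left _ _).trans ((Disj_le_SD _ _).trans (SD_le_one _ _))
    linarith

/-- If all pairs are No instances, a constant map is a reduction. -/
theorem mapsInstances_const_no {a b : ℝ} (hb : b ≤ 0) (hab : a < b) (k : ℕ) :
    MapsInstances (mutIID a b) (mutIID (1 / 2 ^ k) (1 - 1 / 2 ^ k))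
      fun _ => selectorCircuit.pair := by
  refine ⟨fun P hP => ?_, fun P _ => ?_⟩
  · have h1 : SD P.X P.Y ≤ a := hP
    linarith [SD_nonneg P.X P.Y]
  · have h : ∀ c, 1 - 1 / 2 ^ k ≤ selectorCircuit.disj c := fun c => by
      rw [disj_selectorCircuit]
      have : (0 : ℝ) < 1 / 2 ^ k := by positivity
      linarith
    exact le_min (h false) (h true)

theorem MapsInstances.mono {a b a' b' : ℝ} (ha : a ≤ a') (hb : b' ≤ b)
    {Q : PromiseProblem CircuitPair} {f : CircuitPair → CircuitPair}
    (h : MapsInstances (mutIID a' b') Q f) : MapsInstances (mutIID a b) Q f :=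
  ⟨fun P hP => h.1 P (le_trans (show SD P.X P.Y ≤ a from hP) ha),
    fun P hP => h.2 P (le_trans hb (show b ≤ mutDisj P.X P.Y from hP))⟩

theorem mainTheorem4 (a b : ℝ) (hab : a < b) :
    ReducesUniformly (mutIID a b) (fun k => mutIID (1 / 2 ^ k) (1 - 1 / 2 ^ k)) ∧
      ∀ k : ℕ, Reduces (mutIID a b) (mutIID (1 / 2 ^ k) (1 - 1 / 2 ^ k)) := by
  rcases le_or_gt 1 a with ha | ha
  · exact ⟨⟨_, polyTime_const _ _ _, mapsInstances_const_yes ha hab⟩,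
      fun k => ⟨_, polyTime_const _ _ _, mapsInstances_const_yes ha hab k⟩⟩
  rcases le_or_gt b 0 with hb | hb
  · exact ⟨⟨_, polyTime_const _ _ _, mapsInstances_const_no hb hab⟩,
      fun k => ⟨_, polyTime_const _ _ _, mapsInstances_const_no hb hab k⟩⟩
  -- `a` may be nonpositive and `b` may exceed 1. Choosing α strictly above `max a 0` makes the
  -- quotient β/α meaningful, and β is `min b 1`; the promise with α and β is weaker than the given
  -- one.
  have h1 : max a 0 < min b 1 := max_lt (lt_min hab ha) (lt_min hb one_pos)
  obtain ⟨α, hα, hα'⟩ := exists_between h1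
  obtain ⟨h, j, H⟩ := exists_amplified_mapsInstances ((le_max_right a 0).trans_lt hα) hα'
    (min_le_right b 1)
  have H' := fun k => (H k).mono ((le_max_left a 0).trans hα.le) (min_le_left b 1)
  exact ⟨⟨_, polyTime_amplifyPairParam h j, H'⟩, fun k => ⟨_, polyTime_amplifyPair h j k, H' k⟩⟩
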